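/- Let $\mathbb T=\mathbb R/\mathbb Z$ with the wrap-around distance $d$, let $f_c\ge 128$ be an integer, and let $\varphi_k(x)=e^{2\pi i kx}$ for $k\in\{-f_c,\dots,f_c\}$. Let $\Delta=\sum_{j=1}^s\Delta_j e^{i\theta_j}\delta_{T_j}$ be a discrete complex measure on $\mathbb T$ with $\Delta_j>0$, $\theta_j\in\mathbb R$ and pairwise distinct $T_j\in\mathbb T$, whose support $\mathbf S=\{T_1,\dots,T_s\}$ satisfies $$\inf_{T,T'\in\mathbf S,\ T\ne T'}d(T,T')\ \ge\ \frac{2.5}{f_c}.$$ One observes $y_k=\int_{\mathbb T}\varphi_k\,d\Delta+\varepsilon_k$ for $|k|\le f_c$, where $\varepsilon_k=\varepsilon_k^{(1)}+i\,\varepsilon_k^{(2)}$ and the $2(2f_c+1)$ real random variables $\varepsilon_k^{(1)},\varepsilon_k^{(2)}$ are i.i.d. $\mathcal N(0,\sigma^2)$ with $\sigma>0$. Let $$\lambda\ \ge\ \lambda_F:=2\sigma\sqrt{6f_c\log f_c}.$$ Then, with probability at least $1-2\exp\left[-(\log f_c)\,\lambda^2/\lambda_F^2\right]$, every solution $\hat\Delta$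 of $$\min_{\mu}\ \frac12\sum_{|k|\le f_c}\Big|\int_{\mathbb T}\varphi_k\,d\mu-y_k\Big|^2+\lambda\|\mu\|_{TV},$$ the minimum being over all finite complex Borel measures $\mu$ on $\mathbb T$ and $\|\cdot\|_{TV}$ denoting the total variation norm, has the following two properties. 1. For every $x\in\mathbb T$ with $|\hat\Delta(\{x\})|\ge 218\lambda$ there is a unique $T\in\mathbf S$ with $$d(x,T)\le\Big[\frac{\lambda}{0.1678\,|\hat\Delta(\{x\})|}\Big]^{1/2}\frac1{f_c},$$ and this $T$ also satisfies $d(x,T)\le 0.1649/f_c$. 2. For every $j$ with $\Delta_j>218\lambda$ there is a point $\hat T$ in the support of $\hat\Delta$ with $$d(T_j,\hat T)\le\Big[\frac{\lambda}{0.1678\,(\Delta_j-218\lambda)}\Big]^{1/2}\frac1{f_c}.$$ -/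

import Mathlib

open MeasureTheory ProbabilityTheory
open scoped NNReal

namespace SpikeDetection

/-- The frequencies `-f_c, …, f_c`. -/
abbrev Freq (fc : ℕ) : Type := ↥(Finset.Icc (-(fc : ℤ)) (fc : ℤ))

/-- The Fourier sample `∫ exp(2π i k x) dμ(x)` of a complex Borel measure on the circle `ℝ/ℤ`;
the pairing of the integrand with the measure is the multiplication of `ℂ`. -/
noncomputable def fourierSample (μ : ComplexMeasure UnitAddCircle) (k : ℤ) : ℂ :=
  VectorMeasure.integral μ (fun x : UnitAddCircle => fourier k x) (ContinuousLinearMap.mul ℝ ℂ)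

/-- The total variation norm of a complex measure. -/
noncomputable def tvNorm (μ : ComplexMeasure UnitAddCircle) : ℝ :=
  (VectorMeasure.variation μ).real Set.univ

/-- The (closed) support of a complex measure, i.e. the support of its variation. -/
noncomputable def supp (μ : ComplexMeasure UnitAddCircle) : Set UnitAddCircle :=
  (VectorMeasure.variation μ).support

/-- The discrete measure `∑ⱼ aⱼ exp(i θⱼ) δ_{Tⱼ}`. -/
noncomputable def spikeTrain {s : ℕ} (a θ : Fin s → ℝ) (T : Fin s → UnitAddCircle) :
    ComplexMeasure UnitAddCircle :=
  ∑ j, VectorMeasure.dirac (T j) ((a j : ℂ) * Complex.exp (Complex.I * (θ j : ℂ)))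

/-- The objective `½ ‖∫ Φ dμ - y‖₂² + lam ‖μ‖_TV`. -/
noncomputable def blassoObjective (fc : ℕ) (lam : ℝ) (y : Freq fc → ℂ)
    (μ : ComplexMeasure UnitAddCircle) : ℝ :=
  (1 / 2 : ℝ) * ∑ k : Freq fc, ‖fourierSample μ k - y k‖ ^ 2 + lam * tvNorm μ

/-- `μ` minimizes the objective over all finite complex measures on the circle. -/
def IsBlassoSolution (fc : ℕ) (lam : ℝ) (y : Freq fc → ℂ)
    (μ : ComplexMeasure UnitAddCircle) : Prop :=
  IsMinOn (blassoObjective fc lam y) Set.univ μ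

/-- The threshold `λ_F = 2 σ √(6 f_c log f_c)`. -/
noncomputable def lambdaF (σ : ℝ) (fc : ℕ) : ℝ :=
  2 * σ * √(6 * (fc : ℝ) * Real.log fc)

end SpikeDetection

/-! With the required probability the noise vector has Euclidean norm at most `lam / 4`; the rest is
deterministic. Let `p` be a trigonometric polynomial of degree at most `f_c` with `|p| ≤ C`.
Comparing the objective at a solution `μ` with its value at the target, and completing the square in
the data term, gives (`tvNorm_sub_integral_norm_le`) ‖μ‖ - ∫ |p| d|μ| ≤ ∑ a_j (1 - Re (p(T_j)
e^{iθ_j})) + ½ (1/4 + C)² λ. Both properties follow from a suitable choice of `p`; no dual problem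
is solved.

Property 1: take `p(T_j) = e^{-iθ_j}` with `|p| ≤ 1 - 0.019 τ²` near `T_j`, where `τ = π (f_c + 1)
d(x, T_j)`, and `|p| ≤ 0.9` elsewhere. The sum vanishes and the left side is at least `(1 - |p(x)|)
|μ{x}|`, so a heavy atom lies close to some `T_j`.

Property 2: if the support avoids a neighbourhood of `T_j`, the modulus of `p(T_j)` can be raised to
`1 + b` while `|p| ≤ 1` still holds on the support. The left side is then nonnegative and the sum is
`-a_j b`, which forces `a_j b ≤ 0.794 λ`, too small for a large spike.

The polynomials come from `exists_certificate`: Hermite interpolation by translates of the Fejér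
kernel and of its derivative. The kernel and its derivatives decay like the inverse square of the
distance, so separation bounds the interactions between spikes by multiples of `∑ 1/n²`. This makes
the interpolation system a small perturbation of a diagonal one (`interp_coeff_bounds`), and
second-order Taylor estimates give the decay of `|p|`. -/

namespace SpikeDetection

/-! ### Gaussian noise: the event on which its norm is at most `lam / 4`. -/

/-- The exponential moment of the square of a centered Gaussian variable. -/
lemma integral_exp_sq_gaussianReal {v : ℝ≥0} (hv : v ≠ 0) :
    ∫ x, Real.exp (x ^ 2 / (4 * v)) ∂(gaussianReal 0 v) = √2 := by
  have hv' : (0 : ℝ) < v := by exact_mod_cast pos_iff_ne_zero.mpr hv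
  rw [integral_gaussianReal_eq_integral_smul hv]
  have h : ∀ x : ℝ, gaussianPDFReal 0 v x • Real.exp (x ^ 2 / (4 * v))
      = (√(2 * Real.pi * v))⁻¹ * Real.exp (-(1 / (4 * v)) * x ^ 2) := by
    intro x
    rw [gaussianPDFReal, smul_eq_mul, mul_assoc, ← Real.exp_add]
    congr 2
    field_simp
    ring
  simp_rw [h]
  rw [integral_const_mul, integral_gaussian, ← Real.sqrt_inv, ← Real.sqrt_mul (by positivity)]
  congr 1
  field_simp
  norm_num

/-- Chernoff bound for the squared Euclidean norm of a Gaussian vector. -/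
lemma measureReal_sum_sq_ge_le {Ω ι : Type*} [MeasurableSpace Ω] [Fintype ι] {P : Measure Ω}
    [IsProbabilityMeasure P] {X : ι → Ω → ℝ} {v : ℝ≥0} (hv : v ≠ 0)
    (hX : ∀ i, HasLaw (X i) (gaussianReal 0 v) P) (hind : iIndepFun X P) (c : ℝ) :
    P.real {ω | c ≤ ∑ i, X i ω ^ 2} ≤ √2 ^ Fintype.card ι * Real.exp (-(c / (4 * v))) := by
  have hv' : (0 : ℝ) < v := by exact_mod_cast pos_iff_ne_zero.mpr hv
  have hprod : ∫ ω, ∏ i, Real.exp (X i ω ^ 2 / (4 * v)) ∂P = √2 ^ Fintype.card ι := by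
    rw [hind.integral_fun_prod_comp (f := fun _ x => Real.exp (x ^ 2 / (4 * v)))
      (fun i => (hX i).aemeasurable)
      (fun i => by fun_prop)]
    have : ∀ i, ∫ ω, Real.exp (X i ω ^ 2 / (4 * v)) ∂P = √2 := by
      intro i
      rw [← integral_exp_sq_gaussianReal hv, ← (hX i).map_eq,
        integral_map (hX i).aemeasurable (by fun_prop)]
    simp [this]
  have hintegrable : Integrable (fun ω => ∏ i, Real.exp (X i ω ^ 2 / (4 * v))) P := by
    -- A non-integrable function has Bochner integral `0`, so the computed nonzero value already
    -- proves integrability.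
    apply Integrable.of_integral_ne_zero
    rw [hprod]
    positivity
  have hmarkov := mul_meas_ge_le_integral_of_nonneg
    (Filter.Eventually.of_forall fun ω => by positivity) hintegrable (Real.exp (c / (4 * v)))
  rw [hprod] at hmarkov
  have hset : {ω | c ≤ ∑ i, X i ω ^ 2}
      = {ω | Real.exp (c / (4 * v)) ≤ ∏ i, Real.exp (X i ω ^ 2 / (4 * v))} := by
    ext ω
    simp only [Set.mem_ofPred_eq, ← Real.exp_sum, Real.exp_le_exp, ← Finset.sum_div]
    rw [div_le_div_iff_of_pos_right (by positivity)]
  rw [hset, Real.exp_neg, ← div_eq_mul_inv, le_div_iff₀ (Real.exp_pos _), mul_comm]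
  exact hmarkov

lemma lambdaF_sq (σ : ℝ) {fc : ℕ} (hfc : 1 ≤ fc) :
    lambdaF σ fc ^ 2 = 24 * σ ^ 2 * fc * Real.log fc := by
  have : 0 ≤ Real.log fc := Real.log_natCast_nonneg fc
  rw [lambdaF, mul_pow, Real.sq_sqrt (by positivity)]
  ring

lemma lambdaF_pos {σ : ℝ} (hσ : 0 < σ) {fc : ℕ} (hfc : 2 ≤ fc) : 0 < lambdaF σ fc := by
  have : 0 < Real.log fc := Real.log_pos (by exact_mod_cast hfc)
  have : (0 : ℝ) < fc := by exact_mod_cast (by omega : 0 < fc)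
  rw [lambdaF]
  positivity

lemma card_freq (fc : ℕ) : Fintype.card (Freq fc) = 2 * fc + 1 := by
  rw [Fintype.card_coe, Int.card_Icc]
  omega

/-- With the required probability, the Euclidean norm of the noise is at most `lam / 4`. -/
lemma exists_noise_event {Ω : Type*} [MeasurableSpace Ω] (P : Measure Ω) [IsProbabilityMeasure P]
    (fc : ℕ) (hfc : 128 ≤ fc) (σ : ℝ≥0) (hσ : 0 < σ)
    (ε₁ ε₂ : Freq fc → Ω → ℝ)
    (hε₁ : ∀ k, HasLaw (ε₁ k) (gaussianReal 0 (σ ^ 2)) P)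
    (hε₂ : ∀ k, HasLaw (ε₂ k) (gaussianReal 0 (σ ^ 2)) P)
    (hindep : iIndepFun (Sum.elim ε₁ ε₂) P)
    (lam : ℝ) (hlam : lambdaF σ fc ≤ lam) :
    ∃ A : Set Ω, MeasurableSet A ∧
      1 - 2 * Real.exp (-(Real.log fc * (lam ^ 2 / lambdaF σ fc ^ 2))) ≤ P.real A ∧
      ∀ ω ∈ A, ∑ k, ‖(ε₁ k ω : ℂ) + Complex.I * (ε₂ k ω : ℂ)‖ ^ 2 ≤ (lam / 4) ^ 2 := by
  have hσ' : (0 : ℝ) < σ := by exact_mod_cast hσ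
  have hF := lambdaF_pos hσ' (by omega : 2 ≤ fc)
  have hfc' : (128 : ℝ) ≤ fc := by exact_mod_cast hfc
  set B : Set Ω := {ω | (lam / 4) ^ 2 ≤ ∑ i, Sum.elim ε₁ ε₂ i ω ^ 2} with hB
  -- The variables are only a.e. measurable, so `B` is replaced by a measurable hull of the same
  -- probability.
  refine ⟨(toMeasurable P B)ᶜ, (measurableSet_toMeasurable P B).compl, ?_, ?_⟩
  · have hbound : P.real B ≤ 2 * Real.exp (-(Real.log fc * (lam ^ 2 / lambdaF σ fc ^ 2))) := by
      refine (measureReal_sum_sq_ge_le (v := σ ^ 2) (by positivity) ?_ hindep _).trans ?_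
      · rintro (k | k)
        · exact hε₁ k
        · exact hε₂ k
      have hlog2 : 0 < Real.log 2 := Real.log_pos (by norm_num)
      have hlog : 7 * Real.log 2 ≤ Real.log fc := by
        rw [← Real.log_rpow (by norm_num)]
        exact Real.log_le_log (by positivity) (by norm_num; exact hfc)
      have hr : 1 ≤ lam ^ 2 / lambdaF σ fc ^ 2 := by
        rw [one_le_div (by positivity)]
        gcongr
      set r := lam ^ 2 / lambdaF σ fc ^ 2 with hrdef
      have hlam2 : lam ^ 2 = r * (24 * (σ : ℝ) ^ 2 * fc * Real.log fc) := by
        rw [← lambdaF_sq (σ : ℝ) (by omega : 1 ≤ fc), hrdef]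
        field_simp
      have hcard : √2 ^ Fintype.card (Freq fc ⊕ Freq fc) = 2 * Real.exp (2 * fc * Real.log 2) := by
        rw [Fintype.card_sum, card_freq, ← two_mul, pow_mul, Real.sq_sqrt (by norm_num), pow_succ,
          mul_comm, mul_comm (2 * (fc : ℝ)), Real.exp_mul, Real.exp_log (by norm_num)]
        norm_cast
      rw [hcard, mul_assoc, ← Real.exp_add]
      gcongr
      have hexp : (lam / 4) ^ 2 / (4 * ((σ ^ 2 : ℝ≥0) : ℝ)) = 3 / 8 * fc * (Real.log fc * r) := by
        rw [div_pow, hlam2]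
        push_cast
        field_simp
        ring
      rw [hexp]
      -- With `L = log f_c`, the claim is `2 f_c log 2 + L r ≤ (3/8) f_c L r`. Since `128 = 2^7`
      -- gives `L r ≥ 7 log 2`, it reduces to `(5/8) f_c ≥ 7`.
      have h1 : 7 * Real.log 2 ≤ Real.log fc * r := by nlinarith
      nlinarith
    rw [probReal_compl_eq_one_sub (measurableSet_toMeasurable P B), measureReal_def,
      measure_toMeasurable, ← measureReal_def]
    linarith
  · intro ω hω
    have hωB : ω ∉ B := fun h => hω (subset_toMeasurable P B h)
    simp only [hB, Set.mem_ofPred_eq, not_le, Fintype.sum_sum_type, Sum.elim_inl, Sum.elim_inr,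
      ← Finset.sum_add_distrib] at hωB
    refine le_trans (le_of_eq (Finset.sum_congr rfl fun k _ => ?_)) hωB.le
    rw [← Complex.normSq_eq_norm_sq, mul_comm, Complex.normSq_add_mul_I]

end SpikeDetection

/-! ### Pairing measures with trigonometric polynomials, and the variational inequality. -/

namespace SpikeDetection

/-- A complex measure has finite total variation. -/
instance isFiniteMeasure_variation {X : Type*} [MeasurableSpace X] (μ : ComplexMeasure X) :
    IsFiniteMeasure (VectorMeasure.variation μ) := by
  have h : VectorMeasure.variation μ ≤
      (ComplexMeasure.re μ).totalVariation + (ComplexMeasure.im μ).totalVariation := by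
    refine VectorMeasure.variation_le_of_forall_enorm_le fun E _ => ?_
    have h1 := (ComplexMeasure.re μ).enorm_le_totalVariation E
    have h2 := (ComplexMeasure.im μ).enorm_le_totalVariation E
    rw [Measure.add_apply]
    refine le_trans ?_ (add_le_add h1 h2)
    have h3 : μ E = ((ComplexMeasure.re μ E : ℝ) : ℂ) + ((ComplexMeasure.im μ E : ℝ) : ℂ) * Complex.I :=
      (Complex.re_add_im (μ E)).symm
    rw [h3]
    refine (enorm_add_le _ _).trans (le_of_eq ?_)
    simp [← ofReal_norm]
  exact isFiniteMeasure_of_le _ h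

/-- The trigonometric polynomial with coefficients `p`. -/
noncomputable def trigPoly {fc : ℕ} (p : Freq fc → ℂ) : C(UnitAddCircle, ℂ) :=
  ∑ k, p k • fourier (k : ℤ)

lemma trigPoly_apply {fc : ℕ} (p : Freq fc → ℂ) (x : UnitAddCircle) :
    trigPoly p x = ∑ k, p k * fourier (k : ℤ) x := by
  simp [trigPoly]

lemma integrable_continuousMap (μ : ComplexMeasure UnitAddCircle) (f : C(UnitAddCircle, ℂ)) :
    VectorMeasure.Integrable μ (f : UnitAddCircle → ℂ) :=
  f.continuous.integrable_of_hasCompactSupport (HasCompactSupport.of_compactSpace _)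

lemma sum_mul_fourierSample {fc : ℕ} (p : Freq fc → ℂ) (μ : ComplexMeasure UnitAddCircle) :
    ∑ k, p k * fourierSample μ k =
      VectorMeasure.integral μ (trigPoly p) (ContinuousLinearMap.mul ℝ ℂ) := by
  have h : (trigPoly p : UnitAddCircle → ℂ) = fun x => ∑ k, (p k • fourier (k : ℤ)) x := by
    funext x
    simp [trigPoly]
  rw [h, VectorMeasure.integral_finsetSum _ fun k _ => integrable_continuousMap μ _]
  refine Finset.sum_congr rfl fun k _ => ?_
  exact (setToFun_smul _ (fun c s x => by
    simp only [VectorMeasure.transpose]; simp; ring) (p k) _).symm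

lemma norm_sum_mul_fourierSample_le {fc : ℕ} (p : Freq fc → ℂ)
    (μ : ComplexMeasure UnitAddCircle) :
    ‖∑ k, p k * fourierSample μ k‖ ≤ ∫ x, ‖trigPoly p x‖ ∂(VectorMeasure.variation μ) := by
  rw [sum_mul_fourierSample]
  refine VectorMeasure.norm_integral_le_integral_norm.trans (le_of_eq ?_)
  rw [ContinuousLinearMap.opNorm_mul, one_mul]

lemma sum_mul_fourierSample_spikeTrain {fc s : ℕ} (p : Freq fc → ℂ) (a θ : Fin s → ℝ)
    (T : Fin s → UnitAddCircle) :
    ∑ k, p k * fourierSample (spikeTrain a θ T) k =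
      ∑ j, trigPoly p (T j) * ((a j : ℂ) * Complex.exp (Complex.I * (θ j : ℂ))) := by
  rw [sum_mul_fourierSample, spikeTrain, VectorMeasure.integral_finsetSum_vectorMeasure
    fun j _ => integrable_continuousMap _ _]
  simp

lemma tvNorm_spikeTrain_le {s : ℕ} {a : Fin s → ℝ} (ha : ∀ j, 0 < a j) (θ : Fin s → ℝ)
    (T : Fin s → UnitAddCircle) : tvNorm (spikeTrain a θ T) ≤ ∑ j, a j := by
  have h := VectorMeasure.variation_finsetSum_le Finset.univ fun j =>
    VectorMeasure.dirac (T j) ((a j : ℂ) * Complex.exp (Complex.I * (θ j : ℂ)))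
  have h' := h Set.univ
  have hn : ∀ j, ‖(a j : ℂ) * Complex.exp (Complex.I * (θ j : ℂ))‖ₑ = ENNReal.ofReal (a j) := by
    intro j
    rw [← ofReal_norm, norm_mul, mul_comm Complex.I, Complex.norm_exp_ofReal_mul_I, mul_one,
      Complex.norm_real, Real.norm_of_nonneg (ha j).le]
  simp only [VectorMeasure.variation_dirac, hn, Measure.coe_finsetSum, Finset.sum_apply,
    Measure.smul_apply, measure_univ, smul_eq_mul, mul_one] at h'
  rw [← ENNReal.ofReal_sum_of_nonneg fun j _ => (ha j).le] at h'
  exact ENNReal.toReal_le_of_le_ofReal (Finset.sum_nonneg fun j _ => (ha j).le) h'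

/-- Parseval: the `ℓ²` norm of the coefficients is bounded by the supremum. -/
lemma sum_norm_sq_le_of_norm_trigPoly_le {fc : ℕ} {p : Freq fc → ℂ} {C : ℝ} (hC : 0 ≤ C)
    (h : ∀ x, ‖trigPoly p x‖ ≤ C) : ∑ k, ‖p k‖ ^ 2 ≤ C ^ 2 := by
  have horth : Orthonormal ℂ (fun k : Freq fc => fourierLp (T := 1) 2 (k : ℤ)) :=
    orthonormal_fourier.comp _ Subtype.val_injective
  have h1 : ‖∑ k, p k • fourierLp (T := 1) 2 ((k : Freq fc) : ℤ)‖ ^ 2 = ∑ k, ‖p k‖ ^ 2 := by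
    rw [← inner_self_eq_norm_sq (𝕜 := ℂ), horth.inner_sum]
    simp [← Complex.normSq_eq_conj_mul_self, Complex.normSq_eq_norm_sq, -Complex.ofReal_pow]
  have h2 : ∑ k, p k • fourierLp (T := 1) 2 ((k : Freq fc) : ℤ)
      = ContinuousMap.toLp (E := ℂ) 2 AddCircle.haarAddCircle ℂ (trigPoly p) := by
    simp [trigPoly, map_sum, fourierLp]
  rw [← h1, h2]
  gcongr
  refine (ContinuousLinearMap.le_opNorm _ _).trans ?_
  have h3 : ‖trigPoly p‖ ≤ C := (ContinuousMap.norm_le _ hC).2 h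
  have h4 := ContinuousMap.toLp_norm_le (p := 2) (μ := AddCircle.haarAddCircle (T := (1 : ℝ)))
    (E := ℂ) (𝕜 := ℂ)
  simp only [measureUnivNNReal, measure_univ, ENNReal.toNNReal_one, NNReal.coe_one,
    Real.one_rpow] at h4
  calc _ ≤ 1 * ‖trigPoly p‖ := by gcongr
    _ ≤ C := by simpa using h3

/-- Minkowski's inequality for finite families of complex numbers. -/
lemma sum_norm_sub_sq_le {ι : Type*} [Fintype ι] {u v : ι → ℂ} {A B : ℝ} (hA : 0 ≤ A) (hB : 0 ≤ B)
    (hu : ∑ k, ‖u k‖ ^ 2 ≤ A ^ 2) (hv : ∑ k, ‖v k‖ ^ 2 ≤ B ^ 2) :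
    ∑ k, ‖u k - v k‖ ^ 2 ≤ (A + B) ^ 2 := by
  have key : ∀ w : ι → ℂ, ∑ k, ‖w k‖ ^ 2 = ‖WithLp.toLp 2 w‖ ^ 2 := by
    intro w
    rw [EuclideanSpace.norm_sq_eq]
  rw [key] at hu hv
  have hu' := abs_le_of_sq_le_sq hu hA
  have hv' := abs_le_of_sq_le_sq hv hB
  rw [abs_of_nonneg (norm_nonneg _)] at hu' hv'
  have := key (fun k => u k - v k)
  rw [this]
  gcongr
  exact (norm_sub_le (WithLp.toLp 2 u) (WithLp.toLp 2 v)).trans (add_le_add hu' hv')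

/-- Completing the square in the data-fitting term. -/
lemma completing_square_le (e d q : ℂ) (lam : ℝ) :
    1 / 2 * ‖e‖ ^ 2 - 1 / 2 * ‖d - e‖ ^ 2 - lam * (q * d).re
      ≤ 1 / 2 * ‖(starRingEnd ℂ) e - lam * q‖ ^ 2 := by
  simp only [← Complex.normSq_eq_norm_sq, Complex.normSq_apply, Complex.sub_re, Complex.sub_im,
    Complex.mul_re, Complex.mul_im, Complex.conj_re, Complex.conj_im, Complex.ofReal_re,
    Complex.ofReal_im]
  -- The difference of the two sides is `½ |d - e + lam * conj q|²`.
  nlinarith [sq_nonneg (d.re - e.re + lam * q.re), sq_nonneg (d.im - e.im - lam * q.im)]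

/-- The Bregman-type inequality satisfied by every solution, for every test polynomial. -/
lemma tvNorm_sub_integral_norm_le {fc s : ℕ} {lam : ℝ} (hlam : 0 < lam) {a : Fin s → ℝ}
    (ha : ∀ j, 0 < a j) (θ : Fin s → ℝ) (T : Fin s → UnitAddCircle) (ε : Freq fc → ℂ)
    (hε : ∑ k, ‖ε k‖ ^ 2 ≤ (lam / 4) ^ 2) (μ : ComplexMeasure UnitAddCircle)
    (hμ : IsBlassoSolution fc lam (fun k => fourierSample (spikeTrain a θ T) k + ε k) μ)
    (p : Freq fc → ℂ) {C : ℝ} (hC : 0 ≤ C) (hp : ∀ x, ‖trigPoly p x‖ ≤ C) :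
    tvNorm μ - ∫ x, ‖trigPoly p x‖ ∂(VectorMeasure.variation μ) ≤
      ∑ j, a j * (1 - (trigPoly p (T j) * Complex.exp (Complex.I * (θ j : ℂ))).re)
        + 1 / 2 * (1 / 4 + C) ^ 2 * lam := by
  set Δ := spikeTrain a θ T with hΔ
  have hmin : blassoObjective fc lam _ μ ≤ blassoObjective fc lam _ Δ :=
    hμ (Set.mem_univ Δ)
  simp only [blassoObjective] at hmin
  have htv : tvNorm Δ ≤ ∑ j, a j := tvNorm_spikeTrain_le ha θ T
  have hfit1 : ∑ k : Freq fc, ‖fourierSample Δ k - (fourierSample Δ k + ε k)‖ ^ 2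
      = ∑ k, ‖ε k‖ ^ 2 := by
    refine Finset.sum_congr rfl fun k _ => ?_
    rw [sub_add_cancel_left, norm_neg]
  have hfit2 : ∑ k : Freq fc, ‖fourierSample μ k - (fourierSample Δ k + ε k)‖ ^ 2
      = ∑ k : Freq fc, ‖(fourierSample μ k - fourierSample Δ k) - ε k‖ ^ 2 := by
    refine Finset.sum_congr rfl fun k _ => ?_
    rw [sub_sub]
  rw [hfit1, hfit2] at hmin
  have hsq : 1 / 2 * ∑ k, ‖ε k‖ ^ 2
      - 1 / 2 * ∑ k : Freq fc, ‖(fourierSample μ k - fourierSample Δ k) - ε k‖ ^ 2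
      - lam * (∑ k : Freq fc, p k * (fourierSample μ k - fourierSample Δ k)).re
      ≤ 1 / 2 * ∑ k, ‖(starRingEnd ℂ) (ε k) - lam * p k‖ ^ 2 := by
    rw [Complex.re_sum, Finset.mul_sum, Finset.mul_sum, Finset.mul_sum, Finset.mul_sum,
      ← Finset.sum_sub_distrib, ← Finset.sum_sub_distrib]
    exact Finset.sum_le_sum fun k _ => completing_square_le _ _ _ _
  -- By Parseval the coefficients of `p` have `ℓ²` norm at most `C`; Minkowski adds the noise bound
  -- `lam / 4`.
  have hmink : ∑ k, ‖(starRingEnd ℂ) (ε k) - lam * p k‖ ^ 2 ≤ (lam / 4 + lam * C) ^ 2 := by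
    refine sum_norm_sub_sq_le (by positivity) (by positivity) (by simpa using hε) ?_
    have := sum_norm_sq_le_of_norm_trigPoly_le hC hp
    simp only [norm_mul, mul_pow, Complex.norm_real, Real.norm_eq_abs, sq_abs]
    rw [← Finset.mul_sum]
    gcongr
  have hpair : (∑ k : Freq fc, p k * (fourierSample μ k - fourierSample Δ k)).re
      = (∑ k, p k * fourierSample μ k).re
        - ∑ j, a j * (trigPoly p (T j) * Complex.exp (Complex.I * (θ j : ℂ))).re := by
    simp only [mul_sub, Finset.sum_sub_distrib, Complex.sub_re]
    congr 1
    rw [hΔ, sum_mul_fourierSample_spikeTrain, Complex.re_sum]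
    refine Finset.sum_congr rfl fun j _ => ?_
    rw [← Complex.re_ofReal_mul]
    congr 1
    ring
  have hre := (Complex.re_le_norm _).trans (norm_sum_mul_fourierSample_le p μ)
  rw [hpair] at hsq
  simp only [mul_sub, mul_one, Finset.sum_sub_distrib]
  set S := ∑ j, a j * (trigPoly p (T j) * Complex.exp (Complex.I * (θ j : ℂ))).re
  set Q := (∑ k, p k * fourierSample μ k).re
  have h1 : lam * (tvNorm μ - Q) ≤ lam * (∑ j, a j - S + 1 / 2 * (1 / 4 + C) ^ 2 * lam) := by
    have : lam * tvNorm Δ ≤ lam * ∑ j, a j := by gcongr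
    nlinarith
  have h2 := le_of_mul_le_mul_left h1 hlam
  linarith

/-- The right side is the integral of the nonnegative function `1 - |f|` against `|μ|`, hence at
least its part on the atom. -/
lemma one_sub_norm_mul_norm_singleton_le (μ : ComplexMeasure UnitAddCircle)
    (f : C(UnitAddCircle, ℂ)) (hf : ∀ x, ‖f x‖ ≤ 1) (x : UnitAddCircle) :
    (1 - ‖f x‖) * ‖μ {x}‖ ≤ tvNorm μ - ∫ y, ‖f y‖ ∂(VectorMeasure.variation μ) := by
  have hintegrable : Integrable (fun y => ‖f y‖) (VectorMeasure.variation μ) :=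
    (integrable_continuousMap μ f).norm
  have h1 : tvNorm μ - ∫ y, ‖f y‖ ∂(VectorMeasure.variation μ)
      = ∫ y, (1 - ‖f y‖) ∂(VectorMeasure.variation μ) := by
    rw [integral_sub (integrable_const _) hintegrable]
    simp [tvNorm]
  rw [h1]
  calc (1 - ‖f x‖) * ‖μ {x}‖
      ≤ (1 - ‖f x‖) * (VectorMeasure.variation μ).real {x} := by
        gcongr
        · linarith [hf x]
        · exact VectorMeasure.norm_measure_le_variation
    _ = ∫ y in {x}, (1 - ‖f y‖) ∂(VectorMeasure.variation μ) := by
        rw [integral_singleton, smul_eq_mul, mul_comm]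
    _ ≤ _ := setIntegral_le_integral ((integrable_const _).sub hintegrable)
        (Filter.Eventually.of_forall fun y => by simpa using hf y)

/-- A bound on the support suffices because its complement is `|μ|`-null. This lets the test
polynomial exceed `1` near a spike that the solution misses. -/
lemma tvNorm_sub_integral_norm_nonneg (μ : ComplexMeasure UnitAddCircle)
    (f : C(UnitAddCircle, ℂ)) (hf : ∀ x ∈ supp μ, ‖f x‖ ≤ 1) :
    0 ≤ tvNorm μ - ∫ y, ‖f y‖ ∂(VectorMeasure.variation μ) := by
  have h := integral_mono_ae (integrable_continuousMap μ f).norm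
    (integrable_const (μ := VectorMeasure.variation μ) (1 : ℝ))
    (by filter_upwards [Measure.support_mem_ae (μ := VectorMeasure.variation μ)] with x hx
        exact hf x hx)
  simp only [integral_const, smul_eq_mul, mul_one] at h
  rw [tvNorm]
  linarith

end SpikeDetection

/-! ### The Fejér kernel: moments and closed form. -/

namespace SpikeDetection

section SymmetricSums

variable {R : Type*} [CommRing R]

lemma sum_Icc_neg_succ (n : ℕ) (f : ℤ → R) :
    ∑ k ∈ Finset.Icc (-((n + 1 : ℕ) : ℤ)) ((n + 1 : ℕ) : ℤ), f k =
      ∑ k ∈ Finset.Icc (-(n : ℤ)) (n : ℤ), f k + (f (n + 1) + f (-(n + 1))) := by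
  have h : Finset.Icc (-((n + 1 : ℕ) : ℤ)) ((n + 1 : ℕ) : ℤ) =
      insert (-(n + 1 : ℤ)) (insert (n + 1 : ℤ) (Finset.Icc (-(n : ℤ)) (n : ℤ))) := by
    ext k
    simp only [Finset.mem_insert, Finset.mem_Icc]
    omega
  rw [h, Finset.sum_insert, Finset.sum_insert]
  · ring
  · simp
  · simp only [Finset.mem_insert, Finset.mem_Icc]
    omega

/-- Triangular weights are cumulative sums of Dirichlet windows: the old weight `n + 1 - |k|`
vanishes at the two new indices. The general ring serves both the real moments and the complex
closed form. -/
lemma sum_Icc_triangle_succ (n : ℕ) (f : ℤ → R) :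
    ∑ k ∈ Finset.Icc (-((n + 1 : ℕ) : ℤ)) ((n + 1 : ℕ) : ℤ), ((n : R) + 2 - (|k| : ℤ)) * f k =
      ∑ k ∈ Finset.Icc (-(n : ℤ)) (n : ℤ), ((n : R) + 1 - (|k| : ℤ)) * f k +
        ∑ k ∈ Finset.Icc (-((n + 1 : ℕ) : ℤ)) ((n + 1 : ℕ) : ℤ), f k := by
  have h1 : ∀ k : ℤ, ((n : R) + 2 - (|k| : ℤ)) * f k
      = ((n : R) + 1 - (|k| : ℤ)) * f k + f k := fun k => by ring
  simp_rw [h1]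
  rw [Finset.sum_add_distrib, sum_Icc_neg_succ n (fun k => ((n : R) + 1 - (|k| : ℤ)) * f k)]
  have h2 : |(n : ℤ) + 1| = n + 1 := abs_of_nonneg (by positivity)
  have h3 : |-((n : ℤ) + 1)| = n + 1 := by rw [abs_neg, h2]
  rw [h2, h3]
  push_cast
  ring

lemma sum_Icc_neg_eq {f : ℤ → R} {D : ℕ → R} (h0 : D 0 = f 0)
    (hs : ∀ n : ℕ, D (n + 1) = D n + (f (n + 1) + f (-(n + 1)))) (n : ℕ) :
    ∑ k ∈ Finset.Icc (-(n : ℤ)) (n : ℤ), f k = D n := by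
  induction n with
  | zero => simp [h0]
  | succ n ih => rw [sum_Icc_neg_succ, ih, hs]

lemma sum_Icc_triangle_eq {f : ℤ → R} {D F : ℕ → R}
    (hD : ∀ n : ℕ, ∑ k ∈ Finset.Icc (-(n : ℤ)) (n : ℤ), f k = D n) (h0 : F 0 = f 0)
    (hs : ∀ n : ℕ, F (n + 1) = F n + D (n + 1)) (n : ℕ) :
    ∑ k ∈ Finset.Icc (-(n : ℤ)) (n : ℤ), ((n : R) + 1 - (|k| : ℤ)) * f k = F n := by
  induction n with
  | zero => simp [h0]
  | succ n ih =>
    rw [hs, ← ih, ← hD, ← sum_Icc_triangle_succ]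
    refine Finset.sum_congr rfl fun k _ => ?_
    push_cast
    ring

end SymmetricSums

lemma abs_natCast_succ (n : ℕ) : |(n : ℤ) + 1| = n + 1 := abs_of_nonneg (by positivity)

lemma sum_triangle_abs_pow_zero (n : ℕ) :
    ∑ k ∈ Finset.Icc (-(n : ℤ)) (n : ℤ), ((n : ℝ) + 1 - ((|k| : ℤ) : ℝ)) * ((|k| : ℤ) : ℝ) ^ 0 =
      ((n : ℝ) + 1) ^ 2 :=
  sum_Icc_triangle_eq (f := fun k => ((|k| : ℤ) : ℝ) ^ 0)
    (D := fun n => 2 * (n : ℝ) + 1)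
    (F := fun n => ((n : ℝ) + 1) ^ 2)
    (sum_Icc_neg_eq (by simp) fun n => by
      simp only [abs_neg, abs_natCast_succ]; push_cast; ring)
    (by simp) (fun n => by push_cast; ring) n

lemma sum_triangle_abs_pow_one (n : ℕ) :
    ∑ k ∈ Finset.Icc (-(n : ℤ)) (n : ℤ), ((n : ℝ) + 1 - ((|k| : ℤ) : ℝ)) * ((|k| : ℤ) : ℝ) ^ 1 =
      ((n : ℝ) + 1) * (((n : ℝ) + 1) ^ 2 - 1) / 3 :=
  sum_Icc_triangle_eq (f := fun k => ((|k| : ℤ) : ℝ) ^ 1)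
    (D := fun n => (n : ℝ) * (n + 1))
    (F := fun n => ((n : ℝ) + 1) * (((n : ℝ) + 1) ^ 2 - 1) / 3)
    (sum_Icc_neg_eq (by simp) fun n => by
      simp only [abs_neg, abs_natCast_succ]; push_cast; ring)
    (by simp) (fun n => by push_cast; ring) n

lemma sum_triangle_abs_pow_two (n : ℕ) :
    ∑ k ∈ Finset.Icc (-(n : ℤ)) (n : ℤ), ((n : ℝ) + 1 - ((|k| : ℤ) : ℝ)) * ((|k| : ℤ) : ℝ) ^ 2 =
      ((n : ℝ) + 1) ^ 2 * (((n : ℝ) + 1) ^ 2 - 1) / 6 :=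
  sum_Icc_triangle_eq (f := fun k => ((|k| : ℤ) : ℝ) ^ 2)
    (D := fun n => (n : ℝ) * (n + 1) * (2 * n + 1) / 3)
    (F := fun n => ((n : ℝ) + 1) ^ 2 * (((n : ℝ) + 1) ^ 2 - 1) / 6)
    (sum_Icc_neg_eq (by simp) fun n => by
      simp only [abs_neg, abs_natCast_succ]; push_cast; ring)
    (by simp) (fun n => by push_cast; ring) n

lemma sum_triangle_abs_pow_three (n : ℕ) :
    ∑ k ∈ Finset.Icc (-(n : ℤ)) (n : ℤ), ((n : ℝ) + 1 - ((|k| : ℤ) : ℝ)) * ((|k| : ℤ) : ℝ) ^ 3 =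
      ((n : ℝ) + 1) * (((n : ℝ) + 1) ^ 2 - 1) * (3 * ((n : ℝ) + 1) ^ 2 - 2) / 30 :=
  sum_Icc_triangle_eq (f := fun k => ((|k| : ℤ) : ℝ) ^ 3)
    (D := fun n => ((n : ℝ) * (n + 1)) ^ 2 / 2)
    (F := fun n => ((n : ℝ) + 1) * (((n : ℝ) + 1) ^ 2 - 1) * (3 * ((n : ℝ) + 1) ^ 2 - 2) / 30)
    (sum_Icc_neg_eq (by simp) fun n => by
      simp only [abs_neg, abs_natCast_succ]; push_cast; ring)
    (by simp) (fun n => by push_cast; ring) n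

lemma sum_triangle_abs_pow_four (n : ℕ) :
    ∑ k ∈ Finset.Icc (-(n : ℤ)) (n : ℤ), ((n : ℝ) + 1 - ((|k| : ℤ) : ℝ)) * ((|k| : ℤ) : ℝ) ^ 4 =
      ((n : ℝ) + 1) ^ 2 * (((n : ℝ) + 1) ^ 2 - 1) * (2 * ((n : ℝ) + 1) ^ 2 - 3) / 30 :=
  sum_Icc_triangle_eq (f := fun k => ((|k| : ℤ) : ℝ) ^ 4)
    (D := fun n => (n : ℝ) * (n + 1) * (2 * n + 1) * (3 * n ^ 2 + 3 * n - 1) / 15)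
    (F := fun n => ((n : ℝ) + 1) ^ 2 * (((n : ℝ) + 1) ^ 2 - 1) * (2 * ((n : ℝ) + 1) ^ 2 - 3) / 30)
    (sum_Icc_neg_eq (by simp) fun n => by
      simp only [abs_neg, abs_natCast_succ]; push_cast; ring)
    (by simp) (fun n => by push_cast; ring) n

/-- The Fourier coefficients of the Fejér kernel, normalized to have sum `1`. -/
noncomputable def fejerCoeff (N : ℕ) (k : ℤ) : ℝ := ((N : ℝ) + 1 - ((|k| : ℤ) : ℝ)) / (N + 1) ^ 2

lemma fejerCoeff_nonneg {N : ℕ} {k : ℤ} (hk : k ∈ Finset.Icc (-(N : ℤ)) (N : ℤ)) :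
    0 ≤ fejerCoeff N k := by
  have h : |k| ≤ N := abs_le.2 (Finset.mem_Icc.1 hk)
  have h' : ((|k| : ℤ) : ℝ) ≤ N := by exact_mod_cast h
  rw [fejerCoeff]
  apply div_nonneg _ (by positivity)
  linarith

/-- The `n`-th absolute moment of the Fejér coefficients. -/
noncomputable def fejerMoment (N n : ℕ) : ℝ :=
  ∑ k ∈ Finset.Icc (-(N : ℤ)) (N : ℤ), fejerCoeff N k * (2 * ((|k| : ℤ) : ℝ) / (N + 1)) ^ n

lemma fejerMoment_eq (N n : ℕ) :
    fejerMoment N n = (∑ k ∈ Finset.Icc (-(N : ℤ)) (N : ℤ),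
      ((N : ℝ) + 1 - ((|k| : ℤ) : ℝ)) * ((|k| : ℤ) : ℝ) ^ n) * (2 ^ n / ((N : ℝ) + 1) ^ (n + 2)) := by
  rw [fejerMoment, Finset.sum_mul]
  refine Finset.sum_congr rfl fun k _ => ?_
  rw [fejerCoeff, div_pow, mul_pow, pow_add]
  field_simp

lemma fejerMoment_zero (N : ℕ) : fejerMoment N 0 = 1 := by
  rw [fejerMoment_eq, sum_triangle_abs_pow_zero]
  field_simp

lemma fejerMoment_one_le (N : ℕ) : fejerMoment N 1 ≤ 2 / 3 := by
  rw [fejerMoment_eq, sum_triangle_abs_pow_one, ← mul_div_assoc, div_le_iff₀ (by positivity)]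
  have : (0 : ℝ) ≤ N := by positivity
  ring_nf
  nlinarith

lemma fejerMoment_two (N : ℕ) : fejerMoment N 2 = 2 / 3 * (1 - 1 / ((N : ℝ) + 1) ^ 2) := by
  rw [fejerMoment_eq, sum_triangle_abs_pow_two]
  field_simp
  ring

lemma fejerMoment_three_le (N : ℕ) : fejerMoment N 3 ≤ 4 / 5 := by
  rw [fejerMoment_eq, sum_triangle_abs_pow_three, ← mul_div_assoc, div_le_iff₀ (by positivity)]
  have h : (1 : ℝ) ≤ N + 1 := by simp
  set M : ℝ := N + 1
  have h2 : 0 ≤ M * (5 * M ^ 2 - 2) := mul_nonneg (by linarith) (by nlinarith)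
  nlinarith

lemma fejerMoment_four_le (N : ℕ) : fejerMoment N 4 ≤ 16 / 15 := by
  rw [fejerMoment_eq, sum_triangle_abs_pow_four, ← mul_div_assoc, div_le_iff₀ (by positivity)]
  have h : (1 : ℝ) ≤ N + 1 := by simp
  set M : ℝ := N + 1
  have h2 : 0 ≤ M ^ 2 * (5 * M ^ 2 - 3) := mul_nonneg (by positivity) (by nlinarith)
  nlinarith

/-- The Fejér kernel (`n = 0`) and its derivatives, `n`-th derivative divided by `(π (N + 1)) ^ n`. -/
noncomputable def fejerKernel (N n : ℕ) (x : UnitAddCircle) : ℂ :=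
  ∑ k ∈ Finset.Icc (-(N : ℤ)) (N : ℤ),
    (fejerCoeff N k : ℂ) * (2 * Complex.I * k / (N + 1)) ^ n * fourier k x

lemma norm_fejerKernel_le (N n : ℕ) (x : UnitAddCircle) :
    ‖fejerKernel N n x‖ ≤ fejerMoment N n := by
  refine (norm_sum_le _ _).trans (Finset.sum_le_sum fun k hk => le_of_eq ?_)
  have h1 : ‖fourier k x‖ = 1 := Circle.norm_coe _
  have h2 : ‖(N : ℂ) + 1‖ = N + 1 := by
    have : (N : ℂ) + 1 = ((N + 1 : ℝ) : ℂ) := by push_cast; ring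
    rw [this, Complex.norm_real, Real.norm_of_nonneg (by positivity)]
  rw [norm_mul, norm_mul, h1, mul_one, norm_pow, norm_div, norm_mul, norm_mul, h2,
    Complex.norm_real, Real.norm_of_nonneg (fejerCoeff_nonneg hk)]
  simp

lemma hasDerivAt_fejerKernel (N n : ℕ) (x : UnitAddCircle) (t : ℝ) :
    HasDerivAt (fun t : ℝ => fejerKernel N n (x + t))
      (Real.pi * (N + 1) * fejerKernel N (n + 1) (x + t)) t := by
  have hN : (N : ℂ) + 1 ≠ 0 := by exact_mod_cast (Nat.succ_ne_zero N)
  have h : ∀ k : ℤ, HasDerivAt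
      (fun t : ℝ => (fejerCoeff N k : ℂ) * (2 * Complex.I * k / (N + 1)) ^ n * fourier k (x + (t : UnitAddCircle)))
      (Real.pi * (N + 1) * ((fejerCoeff N k : ℂ) * (2 * Complex.I * k / (N + 1)) ^ (n + 1)
        * fourier k (x + (t : UnitAddCircle)))) t := by
    intro k
    have h1 := (hasDerivAt_fourier (T := 1) k t).const_mul
      ((fejerCoeff N k : ℂ) * (2 * Complex.I * k / (N + 1)) ^ n * fourier k x)
    have hmul : ∀ t : ℝ, fourier k (x + (t : UnitAddCircle)) = fourier k x * fourier k (t : UnitAddCircle) := by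
      intro t
      simp [fourier_apply, smul_add, AddCircle.toCircle_add]
    simp only [hmul]
    convert! h1 using 1
    · funext t
      ring
    · rw [pow_succ]
      field_simp
      simp
  have h2 := HasDerivAt.fun_sum (u := Finset.Icc (-(N : ℤ)) (N : ℤ)) fun k _ => h k
  simpa only [fejerKernel, Finset.mul_sum] using h2

lemma fourier_eq_cos_add_sin (k : ℤ) (t : ℝ) : fourier k (t : UnitAddCircle)
    = ((Real.cos (2 * Real.pi * k * t) : ℝ) : ℂ) + (Real.sin (2 * Real.pi * k * t) : ℝ) * Complex.I := by
  rw [fourier_coe_apply, Complex.ofReal_cos, Complex.ofReal_sin, ← Complex.exp_mul_I]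
  congr 1
  push_cast
  ring

/-- The Dirichlet kernel, multiplied out so that zeros of the sine need no separate treatment. -/
lemma sum_fourier_mul_sin (n : ℕ) (t : ℝ) :
    (∑ k ∈ Finset.Icc (-(n : ℤ)) (n : ℤ), fourier k (t : UnitAddCircle)) * (Real.sin (Real.pi * t) : ℂ)
      = (Real.sin ((2 * n + 1) * (Real.pi * t)) : ℝ) := by
  induction n with
  | zero => simp
  | succ n ih =>
    rw [sum_Icc_neg_succ n (fun k => fourier k (t : UnitAddCircle)), add_mul, ih,
      fourier_eq_cos_add_sin, fourier_eq_cos_add_sin]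
    have h1 : 2 * Real.pi * ((-((n : ℤ) + 1) : ℤ) : ℝ) * t = -(2 * ((n + 1) * (Real.pi * t))) := by
      push_cast; ring
    have h2 : 2 * Real.pi * (((n : ℤ) + 1 : ℤ) : ℝ) * t = 2 * ((n + 1) * (Real.pi * t)) := by
      push_cast; ring
    rw [h1, h2, Real.cos_neg, Real.sin_neg]
    have h3 : Real.sin ((2 * ((n + 1 : ℕ) : ℝ) + 1) * (Real.pi * t))
        = Real.sin (2 * ((n + 1) * (Real.pi * t))) * Real.cos (Real.pi * t)
          + Real.cos (2 * ((n + 1) * (Real.pi * t))) * Real.sin (Real.pi * t) := by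
      rw [← Real.sin_add]
      congr 1
      push_cast
      ring
    have h4 : Real.sin ((2 * (n : ℝ) + 1) * (Real.pi * t))
        = Real.sin (2 * ((n + 1) * (Real.pi * t))) * Real.cos (Real.pi * t)
          - Real.cos (2 * ((n + 1) * (Real.pi * t))) * Real.sin (Real.pi * t) := by
      rw [← Real.sin_sub]
      congr 1
      ring
    rw [h3, h4]
    push_cast
    ring

lemma sin_add_mul_sin_sub (A B : ℝ) :
    Real.sin (A + B) * Real.sin (A - B) = Real.sin A ^ 2 - Real.sin B ^ 2 := by
  rw [Real.sin_add, Real.sin_sub]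
  linear_combination Real.sin A ^ 2 * Real.sin_sq_add_cos_sq B
    - Real.sin B ^ 2 * Real.sin_sq_add_cos_sq A

lemma sum_triangle_fourier_mul_sin_sq (n : ℕ) (t : ℝ) :
    (∑ k ∈ Finset.Icc (-(n : ℤ)) (n : ℤ), ((n : ℂ) + 1 - (|k| : ℤ)) * fourier k (t : UnitAddCircle))
        * (Real.sin (Real.pi * t) : ℂ) ^ 2
      = ((Real.sin ((n + 1) * (Real.pi * t)) ^ 2 : ℝ) : ℂ) := by
  induction n with
  | zero => simp
  | succ n ih =>
    have h := sum_Icc_triangle_succ n (fun k => fourier k (t : UnitAddCircle))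
    have h1 : ∀ k : ℤ, (((n + 1 : ℕ) : ℂ) + 1 - (|k| : ℤ)) = (n : ℂ) + 2 - (|k| : ℤ) := by
      intro k
      push_cast
      ring
    simp_rw [h1]
    rw [h, add_mul, ih, sq (Complex.ofReal _), ← mul_assoc (Finset.sum _ _),
      sum_fourier_mul_sin]
    have h2 : Real.sin ((2 * ((n + 1 : ℕ) : ℝ) + 1) * (Real.pi * t)) * Real.sin (Real.pi * t)
        = Real.sin ((((n + 1 : ℕ) : ℝ) + 1) * (Real.pi * t)) ^ 2
          - Real.sin ((n + 1) * (Real.pi * t)) ^ 2 := by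
      have e1 : (2 * ((n + 1 : ℕ) : ℝ) + 1) * (Real.pi * t)
          = (((n + 1 : ℕ) : ℝ) + 1) * (Real.pi * t) + (n + 1) * (Real.pi * t) := by
        push_cast; ring
      have e2 : Real.pi * t
          = (((n + 1 : ℕ) : ℝ) + 1) * (Real.pi * t) - (n + 1) * (Real.pi * t) := by
        push_cast; ring
      rw [e1]
      conv_lhs => enter [2]; rw [e2]
      exact sin_add_mul_sin_sub _ _
    rw [← Complex.ofReal_mul, h2, ← Complex.ofReal_add]
    congr 1
    ring

/-- The closed form of the Fejér kernel. -/
lemma fejerKernel_zero_mul_sin_sq (N : ℕ) (t : ℝ) :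
    fejerKernel N 0 t * ((Real.sin (Real.pi * t) ^ 2 : ℝ) : ℂ)
      = ((Real.sin ((N + 1) * (Real.pi * t)) ^ 2 / (N + 1) ^ 2 : ℝ) : ℂ) := by
  have hN : (N : ℂ) + 1 ≠ 0 := by exact_mod_cast (Nat.succ_ne_zero N)
  have h := sum_triangle_fourier_mul_sin_sq N t
  rw [Complex.ofReal_div, ← h, fejerKernel, Complex.ofReal_pow, ← div_mul_eq_mul_div, Finset.sum_div]
  congr 1
  refine Finset.sum_congr rfl fun k _ => ?_
  rw [fejerCoeff]
  simp only [Complex.ofReal_div, Complex.ofReal_sub, Complex.ofReal_add, Complex.ofReal_natCast,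
    Complex.ofReal_one, Complex.ofReal_intCast, Complex.ofReal_pow, pow_zero, mul_one]
  field_simp

end SpikeDetection

/-! ### Quadratic decay of the Fejér kernel and its derivatives. -/

namespace SpikeDetection

/-- Leibniz' rule for a product, up to order three, with derivatives rescaled by `c`. -/
lemma leibniz_of_mul_eq {c : ℂ} (hc : c ≠ 0)
    {k₀ k₁ k₂ k₃ S₀ S₁ S₂ S₃ R₀ R₁ R₂ R₃ : ℝ → ℂ}
    (hk₀ : ∀ t, HasDerivAt k₀ (c * k₁ t) t) (hk₁ : ∀ t, HasDerivAt k₁ (c * k₂ t) t)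
    (hk₂ : ∀ t, HasDerivAt k₂ (c * k₃ t) t)
    (hS₀ : ∀ t, HasDerivAt S₀ (c * S₁ t) t) (hS₁ : ∀ t, HasDerivAt S₁ (c * S₂ t) t)
    (hS₂ : ∀ t, HasDerivAt S₂ (c * S₃ t) t)
    (hR₀ : ∀ t, HasDerivAt R₀ (c * R₁ t) t) (hR₁ : ∀ t, HasDerivAt R₁ (c * R₂ t) t)
    (hR₂ : ∀ t, HasDerivAt R₂ (c * R₃ t) t) (h : ∀ t, k₀ t * S₀ t = R₀ t) (t : ℝ) :
    k₁ t * S₀ t = R₁ t - k₀ t * S₁ t ∧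
    k₂ t * S₀ t = R₂ t - 2 * (k₁ t * S₁ t) - k₀ t * S₂ t ∧
    k₃ t * S₀ t = R₃ t - 3 * (k₂ t * S₁ t) - 3 * (k₁ t * S₂ t) - k₀ t * S₃ t := by
  have e1 : ∀ t, k₁ t * S₀ t + k₀ t * S₁ t = R₁ t := by
    intro t
    have h1 := (hk₀ t).mul (hS₀ t)
    have h2 : (k₀ * S₀) = R₀ := funext h
    rw [h2] at h1
    apply mul_left_cancel₀ hc
    rw [← h1.unique (hR₀ t)]
    ring
  have e2 : ∀ t, k₂ t * S₀ t + 2 * (k₁ t * S₁ t) + k₀ t * S₂ t = R₂ t := by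
    intro t
    have h1 := ((hk₁ t).mul (hS₀ t)).add ((hk₀ t).mul (hS₁ t))
    have h2 : (k₁ * S₀ + k₀ * S₁) = R₁ := funext e1
    rw [h2] at h1
    apply mul_left_cancel₀ hc
    rw [← h1.unique (hR₁ t)]
    ring
  have e3 : k₃ t * S₀ t + 3 * (k₂ t * S₁ t) + 3 * (k₁ t * S₂ t) + k₀ t * S₃ t = R₃ t := by
    have h1 := (((hk₂ t).mul (hS₀ t)).add (((hk₁ t).mul (hS₁ t)).const_mul 2)).add
      ((hk₀ t).mul (hS₂ t))
    have h2 : ((k₂ * S₀ + fun t => 2 * (k₁ * S₁) t) + k₀ * S₂) = R₂ := funext e2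
    rw [h2] at h1
    apply mul_left_cancel₀ hc
    rw [← h1.unique (hR₂ t)]
    ring
  refine ⟨?_, ?_, ?_⟩
  · rw [← e1 t]; ring
  · rw [← e2 t]; ring
  · rw [← e3]; ring

/-- Differentiating the product identity, rather than a quotient, gives each derivative recursively
from the lower ones. -/
lemma fejerKernel_leibniz (N : ℕ) (t : ℝ) :
    fejerKernel N 1 t * ((Real.sin (Real.pi * t) ^ 2 : ℝ) : ℂ)
      = ((Real.sin (2 * ((N + 1) * (Real.pi * t))) / (N + 1) ^ 2 : ℝ) : ℂ)
        - fejerKernel N 0 t * ((Real.sin (2 * (Real.pi * t)) / (N + 1) : ℝ) : ℂ) ∧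
    fejerKernel N 2 t * ((Real.sin (Real.pi * t) ^ 2 : ℝ) : ℂ)
      = ((2 * Real.cos (2 * ((N + 1) * (Real.pi * t))) / (N + 1) ^ 2 : ℝ) : ℂ)
        - 2 * (fejerKernel N 1 t * ((Real.sin (2 * (Real.pi * t)) / (N + 1) : ℝ) : ℂ))
        - fejerKernel N 0 t * ((2 * Real.cos (2 * (Real.pi * t)) / (N + 1) ^ 2 : ℝ) : ℂ) ∧
    fejerKernel N 3 t * ((Real.sin (Real.pi * t) ^ 2 : ℝ) : ℂ)
      = ((-4 * Real.sin (2 * ((N + 1) * (Real.pi * t))) / (N + 1) ^ 2 : ℝ) : ℂ)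
        - 3 * (fejerKernel N 2 t * ((Real.sin (2 * (Real.pi * t)) / (N + 1) : ℝ) : ℂ))
        - 3 * (fejerKernel N 1 t * ((2 * Real.cos (2 * (Real.pi * t)) / (N + 1) ^ 2 : ℝ) : ℂ))
        - fejerKernel N 0 t * ((-4 * Real.sin (2 * (Real.pi * t)) / (N + 1) ^ 3 : ℝ) : ℂ) := by
  have hN : (0 : ℝ) < N + 1 := by positivity
  have hc : ((Real.pi * (N + 1) : ℝ) : ℂ) ≠ 0 := by
    exact_mod_cast (by positivity : Real.pi * (N + 1 : ℝ) ≠ 0)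
  have hk : ∀ (n : ℕ) (t : ℝ), HasDerivAt (fun t : ℝ => fejerKernel N n t)
      (((Real.pi * (N + 1) : ℝ) : ℂ) * fejerKernel N (n + 1) t) t := by
    intro n t
    have := hasDerivAt_fejerKernel N n 0 t
    simpa using this
  have hofReal : ∀ {f : ℝ → ℝ} {f' t : ℝ}, HasDerivAt f (Real.pi * (N + 1) * f') t →
      HasDerivAt (fun t => (f t : ℂ)) (((Real.pi * (N + 1) : ℝ) : ℂ) * (f' : ℂ)) t := by
    intro f f' t h
    rw [← Complex.ofReal_mul]
    exact h.ofReal_comp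
  have hlin : ∀ c t : ℝ, HasDerivAt (fun t => c * (Real.pi * t)) (c * Real.pi) t := by
    intro c t
    simpa using ((hasDerivAt_id t).const_mul Real.pi).const_mul c
  have hsin : ∀ c t : ℝ, HasDerivAt (fun t => Real.sin (c * (Real.pi * t)))
      (Real.cos (c * (Real.pi * t)) * (c * Real.pi)) t := fun c t => (hlin c t).sin
  have hcos : ∀ c t : ℝ, HasDerivAt (fun t => Real.cos (c * (Real.pi * t)))
      (-Real.sin (c * (Real.pi * t)) * (c * Real.pi)) t := fun c t => (hlin c t).cos
  have h := leibniz_of_mul_eq hc (hk 0) (hk 1) (hk 2)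
    (S₀ := fun t => ((Real.sin (Real.pi * t) ^ 2 : ℝ) : ℂ))
    (S₁ := fun t => ((Real.sin (2 * (Real.pi * t)) / (N + 1) : ℝ) : ℂ))
    (S₂ := fun t => ((2 * Real.cos (2 * (Real.pi * t)) / (N + 1) ^ 2 : ℝ) : ℂ))
    (S₃ := fun t => ((-4 * Real.sin (2 * (Real.pi * t)) / (N + 1) ^ 3 : ℝ) : ℂ))
    (R₀ := fun t => ((Real.sin ((N + 1) * (Real.pi * t)) ^ 2 / (N + 1) ^ 2 : ℝ) : ℂ))
    (R₁ := fun t => ((Real.sin (2 * ((N + 1) * (Real.pi * t))) / (N + 1) ^ 2 : ℝ) : ℂ))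
    (R₂ := fun t => ((2 * Real.cos (2 * ((N + 1) * (Real.pi * t))) / (N + 1) ^ 2 : ℝ) : ℂ))
    (R₃ := fun t => ((-4 * Real.sin (2 * ((N + 1) * (Real.pi * t))) / (N + 1) ^ 2 : ℝ) : ℂ))
    (fun t => hofReal ?_) (fun t => hofReal ?_) (fun t => hofReal ?_) (fun t => hofReal ?_)
    (fun t => hofReal ?_) (fun t => hofReal ?_) (fejerKernel_zero_mul_sin_sq N) t
  · exact h
  · convert! (hsin 1 t).pow 2 using 1
    · funext t; simp
    · rw [Real.sin_two_mul]
      field_simp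
      simp
      ring
  · convert! (hsin 2 t).div_const ((N : ℝ) + 1) using 1
    field_simp
  · convert! ((hcos 2 t).const_mul 2).div_const (((N : ℝ) + 1) ^ 2) using 1
    field_simp
    ring
  · convert! ((hsin (N + 1) t).pow 2).div_const (((N : ℝ) + 1) ^ 2) using 1
    rw [Real.sin_two_mul]
    field_simp
    simp
    ring
  · convert! (hsin (2 * (N + 1)) t).div_const (((N : ℝ) + 1) ^ 2) using 1
    · funext t
      rw [mul_assoc]
    · rw [mul_assoc 2]
      field_simp
  · convert! ((hcos (2 * (N + 1)) t).const_mul 2).div_const (((N : ℝ) + 1) ^ 2) using 1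
    · funext t
      rw [mul_assoc 2 ((N : ℝ) + 1)]
    · rw [mul_assoc 2 ((N : ℝ) + 1)]
      field_simp
      ring

/-- The Fejér kernel and its derivatives in terms of `z = 1 / ((N + 1) |sin (π t)|)`. -/
lemma norm_fejerKernel_le_of_sin (N : ℕ) {t z : ℝ} (hs : Real.sin (Real.pi * t) ≠ 0)
    (hz : z = 1 / ((N + 1) * |Real.sin (Real.pi * t)|)) :
    ‖fejerKernel N 0 t‖ ≤ z ^ 2 ∧ ‖fejerKernel N 1 t‖ ≤ z ^ 2 * (1 + 2 * z) ∧
    ‖fejerKernel N 2 t‖ ≤ z ^ 2 * (2 + 4 * z + 10 * z ^ 2) ∧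
    ‖fejerKernel N 3 t‖ ≤ z ^ 2 * (4 + 12 * z + 30 * z ^ 2 + 80 * z ^ 3) := by
  obtain ⟨e1, e2, e3⟩ := fejerKernel_leibniz N t
  have e0 := fejerKernel_zero_mul_sin_sq N t
  set M : ℝ := N + 1 with hM
  have hMpos : 0 < M := by positivity
  set s := |Real.sin (Real.pi * t)| with hsdef
  have hspos : 0 < s := abs_pos.2 hs
  have hs1 : s ≤ 1 := Real.abs_sin_le_one _
  have hzpos : 0 < z := by rw [hz]; positivity
  have hMz : M * s * z = 1 := by rw [hz]; field_simp
  have hS : ((Real.sin (Real.pi * t) ^ 2 : ℝ) : ℂ) = ((s ^ 2 : ℝ) : ℂ) := by rw [hsdef, sq_abs]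
  rw [hS] at e0 e1 e2 e3
  have key : ∀ (a b : ℂ) (X : ℝ), a * ((s ^ 2 : ℝ) : ℂ) = b → ‖b‖ ≤ X → ‖a‖ ≤ X * (M * z) ^ 2 := by
    intro a b X hab hb
    have h1 : ‖a‖ * s ^ 2 ≤ X := by
      rw [← hab, norm_mul, Complex.norm_real, Real.norm_of_nonneg (by positivity)] at hb
      exact hb
    calc ‖a‖ = ‖a‖ * s ^ 2 * (M * z) ^ 2 := by
          linear_combination (-‖a‖ * (M * s * z + 1)) * hMz
      _ ≤ X * (M * z) ^ 2 := by gcongr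
  have hr : ∀ (y c : ℝ), |y| ≤ c → ‖(y : ℂ)‖ ≤ c := fun y c h => by
    rwa [Complex.norm_real, Real.norm_eq_abs]
  have hsin2 : |Real.sin (2 * (Real.pi * t))| ≤ 2 * s := by
    rw [Real.sin_two_mul, abs_mul, abs_mul, abs_two]
    have := Real.abs_cos_le_one (Real.pi * t)
    nlinarith
  have bS1 : ‖((Real.sin (2 * (Real.pi * t)) / M : ℝ) : ℂ)‖ ≤ 2 * s / M :=
    hr _ _ (by rw [abs_div, abs_of_pos hMpos]; gcongr)
  have bS2 : ‖((2 * Real.cos (2 * (Real.pi * t)) / M ^ 2 : ℝ) : ℂ)‖ ≤ 2 / M ^ 2 :=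
    hr _ _ (by
      rw [abs_div, abs_mul, abs_two, abs_of_pos (by positivity : 0 < M ^ 2)]
      gcongr
      linarith [Real.abs_cos_le_one (2 * (Real.pi * t))])
  have bS3 : ‖((-4 * Real.sin (2 * (Real.pi * t)) / M ^ 3 : ℝ) : ℂ)‖ ≤ 8 * s / M ^ 3 :=
    hr _ _ (by
      rw [abs_div, abs_mul, abs_of_pos (by positivity : 0 < M ^ 3)]
      refine div_le_div_of_nonneg_right ?_ (by positivity)
      norm_num
      linarith)
  have bR0 : ‖((Real.sin (M * (Real.pi * t)) ^ 2 / M ^ 2 : ℝ) : ℂ)‖ ≤ 1 / M ^ 2 :=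
    hr _ _ (by
      rw [abs_div, abs_of_pos (by positivity : 0 < M ^ 2), abs_of_nonneg (sq_nonneg _)]
      gcongr
      exact Real.sin_sq_le_one _)
  have bR1 : ‖((Real.sin (2 * (M * (Real.pi * t))) / M ^ 2 : ℝ) : ℂ)‖ ≤ 1 / M ^ 2 :=
    hr _ _ (by
      rw [abs_div, abs_of_pos (by positivity : 0 < M ^ 2)]
      gcongr
      exact Real.abs_sin_le_one _)
  have bR2 : ‖((2 * Real.cos (2 * (M * (Real.pi * t))) / M ^ 2 : ℝ) : ℂ)‖ ≤ 2 / M ^ 2 :=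
    hr _ _ (by
      rw [abs_div, abs_mul, abs_two, abs_of_pos (by positivity : 0 < M ^ 2)]
      gcongr
      linarith [Real.abs_cos_le_one (2 * (M * (Real.pi * t)))])
  have bR3 : ‖((-4 * Real.sin (2 * (M * (Real.pi * t))) / M ^ 2 : ℝ) : ℂ)‖ ≤ 4 / M ^ 2 :=
    hr _ _ (by
      rw [abs_div, abs_mul, abs_of_pos (by positivity : 0 < M ^ 2)]
      norm_num
      gcongr
      linarith [Real.abs_sin_le_one (2 * (M * (Real.pi * t)))])
  have b0 : ‖fejerKernel N 0 t‖ ≤ z ^ 2 := by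
    refine (key _ _ _ e0 bR0).trans (le_of_eq ?_)
    field_simp
  have b1 : ‖fejerKernel N 1 t‖ ≤ z ^ 2 * (1 + 2 * z) := by
    refine (key _ _ (1 / M ^ 2 + z ^ 2 * (2 * s / M)) e1 ?_).trans (le_of_eq ?_)
    · refine (norm_sub_le _ _).trans (add_le_add bR1 ?_)
      rw [norm_mul]
      gcongr
    · field_simp
      linear_combination 2 * z * hMz
  have b2 : ‖fejerKernel N 2 t‖ ≤ z ^ 2 * (2 + 4 * z + 10 * z ^ 2) := by
    refine (key _ _ (2 / M ^ 2 + 2 * (z ^ 2 * (1 + 2 * z) * (2 * s / M)) + z ^ 2 * (2 / M ^ 2))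
      e2 ?_).trans (le_of_eq ?_)
    · refine (norm_sub_le _ _).trans (add_le_add ((norm_sub_le _ _).trans (add_le_add bR2 ?_)) ?_)
      · rw [norm_mul, norm_mul, Complex.norm_ofNat]
        gcongr
      · rw [norm_mul]
        gcongr
    · field_simp
      linear_combination 4 * (z * (1 + 2 * z)) * hMz
  have b3 : ‖fejerKernel N 3 t‖ ≤ z ^ 2 * (4 + 12 * z + 30 * z ^ 2 + 80 * z ^ 3) := by
    -- Because `s ≤ 1`; this absorbs the extra `1 / M²` of the last Leibniz term into a power of
    -- `z`.
    have hzM : 1 / M ≤ z := by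
      rw [hz]
      apply one_div_le_one_div_of_le (by positivity)
      nlinarith
    have hM3 : 8 * s / M ^ 3 ≤ 8 * s / M * z ^ 2 := by
      calc 8 * s / M ^ 3 = 8 * s / M * (1 / M) ^ 2 := by field_simp
        _ ≤ 8 * s / M * z ^ 2 := by gcongr
    refine (key _ _ (4 / M ^ 2 + 3 * (z ^ 2 * (2 + 4 * z + 10 * z ^ 2) * (2 * s / M))
      + 3 * (z ^ 2 * (1 + 2 * z) * (2 / M ^ 2)) + z ^ 2 * (8 * s / M * z ^ 2))
      e3 ?_).trans (le_of_eq ?_)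
    · refine (norm_sub_le _ _).trans (add_le_add ((norm_sub_le _ _).trans (add_le_add
        ((norm_sub_le _ _).trans (add_le_add bR3 ?_)) ?_)) ?_)
      · rw [norm_mul, norm_mul, Complex.norm_ofNat]
        gcongr
      · rw [norm_mul, norm_mul, Complex.norm_ofNat]
        gcongr
      · rw [norm_mul]
        gcongr
        exact bS3.trans hM3
    · field_simp
      linear_combination (6 * z * (2 + 4 * z + 10 * z ^ 2) + 8 * z ^ 3) * hMz
  exact ⟨b0, b1, b2, b3⟩

/-- The decay profile of the Fejér kernel. -/
noncomputable def decay (N : ℕ) (x : UnitAddCircle) : ℝ :=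
  1 / (Real.pi * (N + 1) * ‖x‖) ^ 2 + 1 / ((N : ℝ) + 1) ^ 2

lemma decay_nonneg (N : ℕ) (x : UnitAddCircle) : 0 ≤ decay N x := by
  rw [decay]; positivity

lemma exists_coe_eq_abs_eq_norm (x : UnitAddCircle) : ∃ t : ℝ, (t : UnitAddCircle) = x ∧ |t| = ‖x‖ := by
  induction x using QuotientAddGroup.induction_on with
  | H r =>
    refine ⟨r - round r, ?_, (UnitAddCircle.norm_eq).symm⟩
    have : ((round r : ℝ) : UnitAddCircle) = 0 := by
      rw [AddCircle.coe_eq_zero_iff]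
      exact ⟨round r, by simp⟩
    rw [AddCircle.coe_sub, this, sub_zero]

/-- Equivalently `1 / sin² y ≤ 1 / y² + 1` for `y > 0`. It follows from `arctan y ≤ y` and `sin
(arctan y) = y / √(1 + y²)`, and explains the two terms of `decay`. -/
lemma sq_le_sin_sq_mul {y : ℝ} (h0 : 0 ≤ y) (h1 : y ≤ Real.pi / 2) :
    y ^ 2 ≤ Real.sin y ^ 2 * (1 + y ^ 2) := by
  have h : Real.sin (Real.arctan y) ≤ Real.sin y := by
    refine Real.sin_le_sin_of_le_of_le_pi_div_two (Real.neg_pi_div_two_lt_arctan y).le h1 ?_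
    rcases h1.lt_or_eq with h | h
    · rw [← Real.arctan_tan (by linarith) h]
      exact Real.arctan_strictMono.monotone ((Real.arctan_tan (by linarith) h).le.trans
        (Real.le_tan h0 h))
    · exact (Real.arctan_lt_pi_div_two y).le.trans h.ge
  rw [Real.sin_arctan] at h
  have h2 : (y / √(1 + y ^ 2)) ^ 2 ≤ Real.sin y ^ 2 := by gcongr
  rw [div_pow, Real.sq_sqrt (by positivity), div_le_iff₀ (by positivity)] at h2
  exact h2

/-- One factor `decay N x` is kept for summation over the points; the remaining powers of `z` are
frozen at a uniform bound `Z`. -/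
lemma norm_fejerKernel_le_decay (N : ℕ) {x : UnitAddCircle} (hx : x ≠ 0) {Z : ℝ} (hZ : 0 ≤ Z)
    (hq : decay N x ≤ Z ^ 2) :
    ‖fejerKernel N 0 x‖ ≤ decay N x ∧ ‖fejerKernel N 1 x‖ ≤ decay N x * (1 + 2 * Z) ∧
    ‖fejerKernel N 2 x‖ ≤ decay N x * (2 + 4 * Z + 10 * Z ^ 2) ∧
    ‖fejerKernel N 3 x‖ ≤ decay N x * (4 + 12 * Z + 30 * Z ^ 2 + 80 * Z ^ 3) := by
  obtain ⟨t, rfl, ht⟩ := exists_coe_eq_abs_eq_norm x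
  have hxpos : 0 < ‖(t : UnitAddCircle)‖ := norm_pos_iff.2 hx
  have hhalf : ‖(t : UnitAddCircle)‖ ≤ 1 / 2 := by
    simpa using AddCircle.norm_le_half_period 1 one_ne_zero (x := (t : UnitAddCircle))
  have hpi := Real.pi_pos
  have habs : Real.sin (Real.pi * t) ^ 2 = Real.sin (Real.pi * |t|) ^ 2 := by
    rcases abs_cases t with ⟨h, _⟩ | ⟨h, _⟩
    · rw [h]
    · rw [h, mul_neg, Real.sin_neg, neg_sq]
  have hsq := sq_le_sin_sq_mul (y := Real.pi * |t|) (by positivity) (by rw [ht]; nlinarith)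
  rw [← habs] at hsq
  have htpos : 0 < |t| := by rw [ht]; exact hxpos
  have hs : Real.sin (Real.pi * t) ≠ 0 := by
    intro h
    rw [h] at hsq
    have : 0 < (Real.pi * |t|) ^ 2 := by positivity
    linarith
  set z : ℝ := 1 / ((N + 1) * |Real.sin (Real.pi * t)|) with hz
  have hzpos : 0 < z := by have := abs_pos.2 hs; rw [hz]; positivity
  have hzq : z ^ 2 ≤ decay N t := by
    have hspos : 0 < Real.sin (Real.pi * t) ^ 2 := by positivity
    rw [hz, decay, ← ht, div_pow, mul_pow, sq_abs, one_pow]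
    rw [div_add_div _ _ (by positivity) (by positivity), div_le_div_iff₀ (by positivity) (by positivity)]
    have : 0 ≤ ((N : ℝ) + 1) ^ 4 * (Real.sin (Real.pi * t) ^ 2 * (1 + (Real.pi * |t|) ^ 2)
      - (Real.pi * |t|) ^ 2) := mul_nonneg (by positivity) (by linarith)
    nlinarith
  have hzZ : z ≤ Z := le_of_sq_le_sq (hzq.trans hq) hZ
  obtain ⟨b0, b1, b2, b3⟩ := norm_fejerKernel_le_of_sin N hs hz
  have hd := decay_nonneg N t
  refine ⟨b0.trans hzq, b1.trans ?_, b2.trans ?_, b3.trans ?_⟩ <;> gcongr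

end SpikeDetection

/-! ### The kernel near the origin. -/

namespace SpikeDetection

lemma fejerKernel_zero_apply_zero (N : ℕ) : fejerKernel N 0 0 = 1 := by
  have h := fejerMoment_zero N
  simp only [fejerMoment, pow_zero, mul_one] at h
  simp only [fejerKernel, pow_zero, mul_one, fourier_eval_zero]
  exact_mod_cast h

lemma fejerKernel_one_apply_zero (N : ℕ) : fejerKernel N 1 0 = 0 := by
  have h : fejerKernel N 1 0 = -fejerKernel N 1 0 := by
    conv_lhs => rw [fejerKernel]
    rw [fejerKernel, ← Finset.sum_neg_distrib]
    refine Finset.sum_nbij' (fun k => -k) (fun k => -k) ?_ ?_ ?_ ?_ ?_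
    · intro k hk
      simp only [Finset.mem_Icc] at hk ⊢
      omega
    · intro k hk
      simp only [Finset.mem_Icc] at hk ⊢
      omega
    · simp
    · simp
    · intro k _
      simp only [fejerCoeff, abs_neg, fourier_eval_zero, pow_one, Int.cast_neg]
      ring
  exact self_eq_neg.1 h

lemma fejerKernel_two_apply_zero (N : ℕ) : fejerKernel N 2 0 = -(fejerMoment N 2 : ℂ) := by
  rw [fejerKernel, fejerMoment, Complex.ofReal_sum, ← Finset.sum_neg_distrib]
  refine Finset.sum_congr rfl fun k _ => ?_
  have h : (((|k| : ℤ) : ℝ) : ℂ) ^ 2 = (k : ℂ) ^ 2 := by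
    have : ((|k| : ℤ) : ℝ) ^ 2 = (k : ℝ) ^ 2 := by
      rw [Int.cast_abs, sq_abs]
    exact_mod_cast this
  rw [Complex.ofReal_mul, Complex.ofReal_pow, Complex.ofReal_div, Complex.ofReal_mul,
    div_pow (Complex.ofReal 2 * _), mul_pow (Complex.ofReal 2), h, fourier_eval_zero, div_pow,
    mul_pow, mul_pow, Complex.I_sq]
  push_cast
  ring

lemma cos_le_taylor (x : ℝ) : Real.cos x ≤ 1 - x ^ 2 / 2 + x ^ 4 / 24 := by
  wlog hx : 0 ≤ x generalizing x
  · have := this (-x) (by linarith)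
    simpa [Even.neg_pow (by decide : Even 4)] using this
  have hderiv : ∀ y : ℝ, HasDerivAt (fun y => 1 - y ^ 2 / 2 + y ^ 4 / 24 - Real.cos y)
      (Real.sin y - (y - y ^ 3 / 6)) y := by
    intro y
    convert! ((((hasDerivAt_pow 2 y).div_const 2).const_sub 1).add
      ((hasDerivAt_pow 4 y).div_const 24)).sub (Real.hasDerivAt_cos y) using 1
    ring
  have hmono : MonotoneOn (fun y => 1 - y ^ 2 / 2 + y ^ 4 / 24 - Real.cos y) (Set.Ici 0) := by
    refine monotoneOn_of_deriv_nonneg (convex_Ici 0)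
      (fun y _ => (hderiv y).continuousAt.continuousWithinAt)
      (fun y _ => (hderiv y).differentiableAt.differentiableWithinAt) fun y hy => ?_
    rw [(hderiv y).deriv]
    rw [interior_Ici] at hy
    linarith [Real.sin_ge_sub_cube (Set.mem_Ioi.1 hy).le]
  have := hmono (Set.mem_Ici.2 le_rfl) (Set.mem_Ici.2 hx) hx
  simp at this
  linarith

lemma fejerKernel_zero_re_le (N : ℕ) (t : ℝ) :
    (fejerKernel N 0 t).re ≤ 1 - fejerMoment N 2 / 2 * (Real.pi * (N + 1) * |t|) ^ 2
      + 2 / 45 * (Real.pi * (N + 1) * |t|) ^ 4 := by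
  have hN : (0 : ℝ) < N + 1 := by positivity
  set τ := Real.pi * (N + 1) * |t| with hτ
  have hre : (fejerKernel N 0 t).re
      = ∑ k ∈ Finset.Icc (-(N : ℤ)) (N : ℤ), fejerCoeff N k * Real.cos (2 * Real.pi * k * t) := by
    rw [fejerKernel, Complex.re_sum]
    refine Finset.sum_congr rfl fun k _ => ?_
    rw [pow_zero, mul_one, fourier_eq_cos_add_sin, Complex.re_ofReal_mul]
    simp only [Complex.add_re, Complex.ofReal_re, Complex.mul_re, Complex.I_re, Complex.ofReal_im,
      Complex.I_im]
    ring
  have hbound : (fejerKernel N 0 t).re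
      ≤ fejerMoment N 0 - fejerMoment N 2 / 2 * τ ^ 2 + fejerMoment N 4 / 24 * τ ^ 4 := by
    rw [hre]
    simp only [fejerMoment, Finset.sum_div, Finset.sum_mul]
    rw [← Finset.sum_sub_distrib, ← Finset.sum_add_distrib]
    refine Finset.sum_le_sum fun k hk => ?_
    have h1 : (2 * Real.pi * k * t) ^ 2 = (2 * ((|k| : ℤ) : ℝ) / (N + 1)) ^ 2 * τ ^ 2 := by
      rw [hτ, Int.cast_abs, mul_pow _ |t|, sq_abs, div_pow, mul_pow 2 |(k : ℝ)|, sq_abs]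
      field_simp
    have h2 : (2 * Real.pi * k * t) ^ 4 = (2 * ((|k| : ℤ) : ℝ) / (N + 1)) ^ 4 * τ ^ 4 := by
      calc (2 * Real.pi * k * t) ^ 4 = ((2 * Real.pi * k * t) ^ 2) ^ 2 := by ring
        _ = _ := by rw [h1]; ring
    have h3 := cos_le_taylor (2 * Real.pi * k * t)
    rw [h1, h2] at h3
    have h4 := mul_le_mul_of_nonneg_left h3 (fejerCoeff_nonneg hk)
    calc _ ≤ _ := h4
      _ = _ := by ring
  have h4 := fejerMoment_four_le N
  rw [fejerMoment_zero] at hbound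
  have : fejerMoment N 4 / 24 * τ ^ 4 ≤ 2 / 45 * τ ^ 4 := by
    refine mul_le_mul_of_nonneg_right ?_ (by positivity)
    linarith
  linarith

/-- By its closed form the kernel is real and nonnegative, so its norm is its real part, to which
the Taylor bound for the cosine applies. -/
lemma norm_fejerKernel_zero_le (N : ℕ) (x : UnitAddCircle) :
    ‖fejerKernel N 0 x‖ ≤ 1 - fejerMoment N 2 / 2 * (Real.pi * (N + 1) * ‖x‖) ^ 2
      + 2 / 45 * (Real.pi * (N + 1) * ‖x‖) ^ 4 := by
  obtain ⟨t, rfl, ht⟩ := exists_coe_eq_abs_eq_norm x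
  rw [← ht]
  refine le_trans (le_of_eq ?_) (fejerKernel_zero_re_le N t)
  by_cases hs : Real.sin (Real.pi * t) = 0
  · have ht0 : (t : UnitAddCircle) = 0 := by
      obtain ⟨n, hn⟩ := Real.sin_eq_zero_iff.1 hs
      rw [AddCircle.coe_eq_zero_iff]
      refine ⟨n, ?_⟩
      have := mul_left_cancel₀ Real.pi_ne_zero ((mul_comm _ _).trans hn)
      simpa using this
    rw [ht0, fejerKernel_zero_apply_zero]
    simp
  · have h := fejerKernel_zero_mul_sin_sq N t
    have hs2 : (0 : ℝ) < Real.sin (Real.pi * t) ^ 2 := by positivity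
    have hk : fejerKernel N 0 t = ((Real.sin ((N + 1) * (Real.pi * t)) ^ 2 / (N + 1) ^ 2
        / Real.sin (Real.pi * t) ^ 2 : ℝ) : ℂ) := by
      rw [Complex.ofReal_div, eq_div_iff (by exact_mod_cast hs2.ne')]
      exact h
    rw [hk, Complex.norm_real, Complex.ofReal_re, Real.norm_of_nonneg (by positivity)]

/-! ### Kernel sums over separated points. -/

section Separation

variable {s : ℕ} {T : Fin s → UnitAddCircle} {D : ℝ}

/-- The points of a `D`-separated family are ranked by their position relative to one of them. -/
lemma exists_rank (hD : 0 < D) (hT : ∀ i j, i ≠ j → D ≤ ‖T i - T j‖) (j : Fin s) :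
    ∃ n : Fin s → ℤ, Set.InjOn n {i | i ≠ j} ∧
      ∀ i, i ≠ j → n i ≠ 0 ∧ |(n i : ℝ)| * D ≤ ‖T i - T j‖ := by
  choose u hu hu' using fun i => exists_coe_eq_abs_eq_norm (T i - T j)
  have hdist : ∀ i i', ‖T i - T i'‖ ≤ |u i - u i'| := by
    intro i i'
    have h : T i - T i' = ((u i - u i' : ℝ) : UnitAddCircle) := by
      rw [AddCircle.coe_sub, hu, hu]
      abel
    rw [h, UnitAddCircle.norm_eq]
    exact round_le (u i - u i') 0 |>.trans (by simp)
  -- The rank is the floor of `|u i| / D` carrying the sign of `u i`. Two points of equal nonzero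
  -- rank would lie in one cell of length `D`, against the separation.
  have hn : ∀ i, ∃ n : ℤ, |(n : ℝ)| * D ≤ |u i| ∧ |u i| < (|(n : ℝ)| + 1) * D ∧
      0 ≤ n * u i ∧ (D ≤ |u i| → n ≠ 0) := by
    intro i
    have hfl := Int.floor_le (|u i| / D)
    have hlt := Int.lt_floor_add_one (|u i| / D)
    rw [le_div_iff₀ hD] at hfl
    rw [div_lt_iff₀ hD] at hlt
    have hpos : 0 ≤ ⌊|u i| / D⌋ := Int.floor_nonneg.2 (by positivity)
    have hpos' : (0 : ℝ) ≤ (⌊|u i| / D⌋ : ℝ) := by exact_mod_cast hpos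
    have hne : D ≤ |u i| → ⌊|u i| / D⌋ ≠ 0 := by
      intro h
      have : 1 ≤ ⌊|u i| / D⌋ := by
        rw [Int.le_floor, le_div_iff₀ hD]
        simpa using h
      omega
    rcases le_total 0 (u i) with h | h
    · refine ⟨⌊|u i| / D⌋, ?_, ?_, by positivity, hne⟩
      · rwa [abs_of_nonneg hpos']
      · rwa [abs_of_nonneg hpos']
    · refine ⟨-⌊|u i| / D⌋, ?_, ?_, ?_, fun h => neg_ne_zero.2 (hne h)⟩
      · rwa [Int.cast_neg, abs_neg, abs_of_nonneg hpos']
      · rwa [Int.cast_neg, abs_neg, abs_of_nonneg hpos']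
      · rw [Int.cast_neg]
        nlinarith
  choose n hn1 hn2 hn3 hn4 using hn
  have hsep : ∀ i, i ≠ j → D ≤ |u i| := fun i hi => by rw [hu']; exact hT i j hi
  refine ⟨n, ?_, fun i hi => ⟨hn4 i (hsep i hi), by rw [← hu']; exact hn1 i⟩⟩
  intro i hi i' hi' heq
  by_contra hne
  have h1 := (hT i i' hne).trans (hdist i i')
  have hn0 : (n i : ℝ) ≠ 0 := by exact_mod_cast hn4 i (hsep i hi)
  have a1 := hn1 i
  have a2 := hn2 i
  have a3 := hn3 i
  have b1 := hn1 i'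
  have b2 := hn2 i'
  have b3 := hn3 i'
  rw [← heq] at b1 b2 b3
  rcases lt_or_gt_of_ne hn0 with h | h
  · have hui : u i ≤ 0 := by
      by_contra hc
      push Not at hc
      nlinarith
    have hui' : u i' ≤ 0 := by
      by_contra hc
      push Not at hc
      nlinarith
    rw [abs_of_nonpos hui] at a1 a2
    rw [abs_of_nonpos hui'] at b1 b2
    have : |u i - u i'| < D := by rw [abs_lt]; constructor <;> linarith
    linarith
  · have hui : 0 ≤ u i := by
      by_contra hc
      push Not at hc
      nlinarith
    have hui' : 0 ≤ u i' := by
      by_contra hc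
      push Not at hc
      nlinarith
    rw [abs_of_nonneg hui] at a1 a2
    rw [abs_of_nonneg hui'] at b1 b2
    have : |u i - u i'| < D := by rw [abs_lt]; constructor <;> linarith
    linarith

/-- The term `n = 0` contributes `1 / 0 = 0`. -/
lemma hasSum_int_one_div_sq : HasSum (fun n : ℤ => 1 / (n : ℝ) ^ 2) (Real.pi ^ 2 / 3) := by
  have h1 : HasSum (fun n : ℕ => 1 / ((n : ℤ) : ℝ) ^ 2) (Real.pi ^ 2 / 6) := by
    simpa using hasSum_zeta_two
  have h2 : HasSum (fun n : ℕ => 1 / ((-((n : ℤ) + 1) : ℤ) : ℝ) ^ 2) (Real.pi ^ 2 / 6) := by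
    have := (hasSum_nat_add_iff' (f := fun n : ℕ => 1 / (n : ℝ) ^ 2) 1).2 hasSum_zeta_two
    simp only [Finset.range_one, Finset.sum_singleton, Nat.cast_zero, ne_eq, OfNat.ofNat_ne_zero,
      not_false_eq_true, zero_pow, div_zero, sub_zero] at this
    refine this.congr_fun fun n => ?_
    push_cast
    rw [neg_sq]
  have h3 := HasSum.of_nat_of_neg_add_one (f := fun n : ℤ => 1 / (n : ℝ) ^ 2) h1 h2
  rwa [show Real.pi ^ 2 / 6 + Real.pi ^ 2 / 6 = Real.pi ^ 2 / 3 by ring] at h3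

lemma sum_one_div_sq_le {ι : Type*} (S : Finset ι) {n : ι → ℤ} (hn : Set.InjOn n S) :
    ∑ i ∈ S, 1 / (n i : ℝ) ^ 2 ≤ Real.pi ^ 2 / 3 := by
  classical
  rw [← Finset.sum_image (f := fun m : ℤ => 1 / (m : ℝ) ^ 2) hn]
  exact sum_le_hasSum _ (fun m _ => by positivity) hasSum_int_one_div_sq

lemma card_le_of_injOn_of_abs_le {ι : Type*} (S : Finset ι) {n : ι → ℤ} (hn : Set.InjOn n S)
    {L : ℝ} (hL : 0 ≤ L) (h0 : ∀ i ∈ S, n i ≠ 0) (h : ∀ i ∈ S, |(n i : ℝ)| ≤ L) :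
    (S.card : ℝ) ≤ 2 * L := by
  classical
  have h1 : S.image n ⊆ (Finset.Icc (-⌊L⌋) ⌊L⌋).erase 0 := by
    intro m hm
    obtain ⟨i, hi, rfl⟩ := Finset.mem_image.1 hm
    have h2 := abs_le.1 (h i hi)
    rw [Finset.mem_erase, Finset.mem_Icc]
    refine ⟨h0 i hi, ?_, Int.le_floor.2 h2.2⟩
    have h3 : -n i ≤ ⌊L⌋ := by
      rw [Int.le_floor]
      push_cast
      linarith
    linarith
  have h2 := Finset.card_le_card h1
  have hfl : 0 ≤ ⌊L⌋ := Int.floor_nonneg.2 hL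
  rw [Finset.card_image_of_injOn hn, Finset.card_erase_of_mem (by simp [hfl]), Int.card_Icc] at h2
  have h3 : (S.card : ℤ) ≤ 2 * ⌊L⌋ := by omega
  have h4 : (S.card : ℝ) ≤ 2 * (⌊L⌋ : ℝ) := by exact_mod_cast h3
  linarith [Int.floor_le L]

/-- Summation of the decay profile over all but one of the points. -/
lemma sum_decay_le {N : ℕ} (hN : 0 < N) {n : Fin s → ℤ} {j : Fin s}
    (hninj : Set.InjOn n {i | i ≠ j})
    (hn : ∀ i, i ≠ j → n i ≠ 0 ∧ |(n i : ℝ)| * (2.5 / N) ≤ ‖T i - T j‖)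
    {c : ℝ} (hc : 0 < c) {x : UnitAddCircle}
    (hx : ∀ i, i ≠ j → c * |(n i : ℝ)| ≤ (N + 1) * ‖x - T i‖) :
    ∑ i ∈ Finset.univ.erase j, decay N (x - T i) ≤ 1 / (3 * c ^ 2) + 0.4 / (N + 1) := by
  have hN' : (0 : ℝ) < N := by exact_mod_cast hN
  have hinj : Set.InjOn n (Finset.univ.erase j : Finset (Fin s)) := by
    simpa [Set.InjOn] using hninj
  -- Distances on the circle are at most `1/2`, so ranks are at most `N / 5` in absolute value. This
  -- count controls the constant term of `decay`.
  have hcard : (((Finset.univ.erase j : Finset (Fin s)).card : ℕ) : ℝ) ≤ 2 * (N / 5) := by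
    refine card_le_of_injOn_of_abs_le _ hinj (by positivity)
      (fun i hi => (hn i (Finset.ne_of_mem_erase hi)).1) fun i hi => ?_
    have h1 := (hn i (Finset.ne_of_mem_erase hi)).2
    have h2 : ‖T i - T j‖ ≤ 1 / 2 := by
      simpa using AddCircle.norm_le_half_period 1 one_ne_zero (x := T i - T j)
    have h3 := h1.trans h2
    rw [← mul_div_assoc, div_le_iff₀ hN'] at h3
    linarith
  have hterm : ∀ i ∈ (Finset.univ.erase j : Finset (Fin s)), decay N (x - T i)
      ≤ 1 / (Real.pi * c) ^ 2 * (1 / (n i : ℝ) ^ 2) + 1 / ((N : ℝ) + 1) ^ 2 := by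
    intro i hi
    have hi' := Finset.ne_of_mem_erase hi
    have hn0 : 0 < |(n i : ℝ)| := abs_pos.2 (by exact_mod_cast (hn i hi').1)
    rw [decay, ← sq_abs (n i : ℝ), one_div_mul_one_div, ← mul_pow]
    gcongr ?_ + _
    rw [mul_assoc, mul_assoc]
    have := hx i hi'
    gcongr
  refine (Finset.sum_le_sum hterm).trans ?_
  rw [Finset.sum_add_distrib, ← Finset.mul_sum, Finset.sum_const, nsmul_eq_mul]
  have h1 : 1 / (Real.pi * c) ^ 2 * ∑ i ∈ Finset.univ.erase j, 1 / (n i : ℝ) ^ 2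
      ≤ 1 / (Real.pi * c) ^ 2 * (Real.pi ^ 2 / 3) := by
    gcongr
    exact sum_one_div_sq_le _ hinj
  have h2 : 1 / (Real.pi * c) ^ 2 * (Real.pi ^ 2 / 3) = 1 / (3 * c ^ 2) := by
    have := Real.pi_pos
    field_simp
  have h3 : (((Finset.univ.erase j : Finset (Fin s)).card : ℕ) : ℝ) * (1 / ((N : ℝ) + 1) ^ 2)
      ≤ 0.4 / (N + 1) := by
    rw [mul_one_div, div_le_div_iff₀ (by positivity) (by positivity)]
    nlinarith
  linarith

end Separation

lemma decay_le {N : ℕ} (hN : 128 ≤ N) {x : UnitAddCircle} {c : ℝ} (hc : 0 < c)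
    (hx : c ≤ (N + 1) * ‖x‖) : decay N x ≤ 1 / (9.869 * c ^ 2) + 0.0001 := by
  have hN' : (129 : ℝ) ≤ N + 1 := by exact_mod_cast (by omega : 129 ≤ N + 1)
  have hpi := Real.pi_gt_d6
  rw [decay]
  gcongr
  · calc 9.869 * c ^ 2 ≤ (Real.pi * c) ^ 2 := by
          rw [mul_pow]
          gcongr
          nlinarith
      _ ≤ (Real.pi * (N + 1) * ‖x‖) ^ 2 := by
          rw [mul_assoc]
          gcongr
  · rw [div_le_iff₀ (by positivity)]
    nlinarith

end SpikeDetection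

/-! ### Hermite interpolation and the certificate. -/

namespace SpikeDetection

variable {s : ℕ}

/-- The combination of translates of the Fejér kernel with coefficients `α` and of its derivative
with coefficients `β` (`n = 0`), and its rescaled derivatives. -/
noncomputable def interp (N : ℕ) (T : Fin s → UnitAddCircle) (α β : Fin s → ℂ) (n : ℕ)
    (x : UnitAddCircle) : ℂ :=
  ∑ i, (α i * fejerKernel N n (x - T i) + β i * fejerKernel N (n + 1) (x - T i))

lemma hasDerivAt_interp (N : ℕ) (T : Fin s → UnitAddCircle) (α β : Fin s → ℂ) (n : ℕ)
    (x : UnitAddCircle) (t : ℝ) :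
    HasDerivAt (fun t : ℝ => interp N T α β n (x + t))
      (Real.pi * (N + 1) * interp N T α β (n + 1) (x + t)) t := by
  have h : ∀ i, HasDerivAt (fun t : ℝ => α i * fejerKernel N n (x + t - T i)
        + β i * fejerKernel N (n + 1) (x + t - T i))
      (Real.pi * (N + 1) * (α i * fejerKernel N (n + 1) (x + t - T i)
        + β i * fejerKernel N (n + 1 + 1) (x + t - T i))) t := by
    intro i
    have e : ∀ t : ℝ, x + (t : UnitAddCircle) - T i = (x - T i) + t := fun t => by abel
    simp only [e]
    convert! ((hasDerivAt_fejerKernel N n (x - T i) t).const_mul (α i)).add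
      ((hasDerivAt_fejerKernel N (n + 1) (x - T i) t).const_mul (β i)) using 1
    ring
  have h2 := HasDerivAt.fun_sum (u := Finset.univ) fun i _ => h i
  simpa only [interp, Finset.mul_sum] using h2

/-- Translation and differentiation only multiply Fourier coefficients, so the degree stays at most
`fc`. -/
lemma exists_trigPoly_eq_interp (fc : ℕ) (T : Fin s → UnitAddCircle) (α β : Fin s → ℂ) :
    ∃ p : Freq fc → ℂ, ∀ x, trigPoly p x = interp fc T α β 0 x := by
  refine ⟨fun k => ∑ i, (fejerCoeff fc k : ℂ) * fourier (k : ℤ) (-T i)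
    * (α i + β i * (2 * Complex.I * (k : ℤ) / (fc + 1))), fun x => ?_⟩
  have hmul : ∀ (k : ℤ) i, fourier k (x - T i) = fourier k (-T i) * fourier k x := by
    intro k i
    rw [sub_eq_neg_add]
    simp [fourier_apply, smul_add, AddCircle.toCircle_add]
  simp only [trigPoly_apply, interp, fejerKernel, Finset.mul_sum, ← Finset.sum_add_distrib,
    Finset.sum_mul]
  rw [Finset.sum_comm]
  refine Finset.sum_congr rfl fun i _ => ?_
  rw [← Finset.sum_coe_sort (Finset.Icc (-(fc : ℤ)) (fc : ℤ))]
  refine Finset.sum_congr rfl fun k _ => ?_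
  rw [hmul]
  ring

/-- A function of one real variable vanishing to second order. -/
lemma norm_le_of_norm_second_deriv_le {f f' f'' : ℝ → ℂ} {C r : ℝ}
    (hf : ∀ t, HasDerivAt f (f' t) t) (hf' : ∀ t, HasDerivAt f' (f'' t) t) (h0 : f 0 = 0)
    (h0' : f' 0 = 0) (hC : ∀ t, |t| ≤ r → ‖f'' t‖ ≤ C) {t : ℝ} (ht : |t| ≤ r) :
    ‖f t‖ ≤ C / 2 * t ^ 2 := by
  wlog hpos : 0 ≤ t generalizing f f' f'' t
  · have := this (f := fun t => f (-t)) (f' := fun t => -f' (-t)) (f'' := fun t => f'' (-t))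
      (t := -t) (fun t => by
        simpa [Function.comp_def] using (hf (-t)).scomp t (hasDerivAt_neg t))
      (fun t => by
        simpa [Function.comp_def] using ((hf' (-t)).scomp t (hasDerivAt_neg t)).fun_neg) (by simpa using h0)
      (by simpa using h0') (fun t ht => hC _ (by simpa using ht)) (by simpa using ht)
      (by linarith)
    simpa using this
  have hr : ∀ u ∈ Set.Icc 0 t, |u| ≤ r := by
    intro u hu
    rw [abs_of_nonneg hu.1]
    rw [abs_of_nonneg hpos] at ht
    exact hu.2.trans ht
  have h1 : ∀ u ∈ Set.Icc 0 t, ‖f' u‖ ≤ C * u := by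
    intro u hu
    refine image_norm_le_of_norm_deriv_right_le_deriv_boundary (f' := f'') (B := fun u => C * u)
      (B' := fun _ => C) (fun u _ => (hf' u).continuousAt.continuousWithinAt)
      (fun u _ => (hf' u).hasDerivWithinAt) (by simp [h0']) (fun u => ?_)
      (fun u hu => hC u (hr u (Set.Ico_subset_Icc_self hu))) hu
    simpa using (hasDerivAt_id u).const_mul C
  refine image_norm_le_of_norm_deriv_right_le_deriv_boundary (f' := f')
    (B := fun u => C / 2 * u ^ 2) (B' := fun u => C * u)
    (fun u _ => (hf u).continuousAt.continuousWithinAt)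
    (fun u _ => (hf u).hasDerivWithinAt) (by simp [h0]) (fun u => ?_)
    (fun u hu => h1 u (Set.Ico_subset_Icc_self hu)) (Set.right_mem_Icc.2 hpos)
  convert! (hasDerivAt_pow 2 u).const_mul (C / 2) using 1
  ring

lemma norm_sum_mul_add_mul_le {ι : Type*} (S : Finset ι) {α β κ κ' : ι → ℂ} {A B X Y : ℝ}
    (hA0 : 0 ≤ A) (hB0 : 0 ≤ B) (hA : ∀ i, ‖α i‖ ≤ A) (hB : ∀ i, ‖β i‖ ≤ B)
    (hX : ∑ i ∈ S, ‖κ i‖ ≤ X) (hY : ∑ i ∈ S, ‖κ' i‖ ≤ Y) :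
    ‖∑ i ∈ S, (α i * κ i + β i * κ' i)‖ ≤ A * X + B * Y := by
  calc ‖∑ i ∈ S, (α i * κ i + β i * κ' i)‖
      ≤ ∑ i ∈ S, (A * ‖κ i‖ + B * ‖κ' i‖) := by
        refine (norm_sum_le _ _).trans (Finset.sum_le_sum fun i _ => ?_)
        refine (norm_add_le _ _).trans ?_
        rw [norm_mul, norm_mul]
        gcongr
        · exact hA i
        · exact hB i
    _ = A * ∑ i ∈ S, ‖κ i‖ + B * ∑ i ∈ S, ‖κ' i‖ := by
        rw [Finset.sum_add_distrib, Finset.mul_sum, Finset.mul_sum]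
    _ ≤ A * X + B * Y := by gcongr

/-- Kernel sums over all points but one, as seen from a point `x` whose distances to these points
dominate `c` times their ranks. -/
lemma sum_norm_fejerKernel_le {N : ℕ} (hN : 128 ≤ N) {T : Fin s → UnitAddCircle} {n : Fin s → ℤ}
    {j : Fin s} (hninj : Set.InjOn n {i | i ≠ j})
    (hn : ∀ i, i ≠ j → n i ≠ 0 ∧ |(n i : ℝ)| * (2.5 / N) ≤ ‖T i - T j‖)
    {c Z Q : ℝ} (hc : 0 < c) (hZ : 0 ≤ Z) (hcZ : 1 / (9.869 * c ^ 2) + 0.0001 ≤ Z ^ 2)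
    (hcQ : 1 / (3 * c ^ 2) + 0.0032 ≤ Q) {x : UnitAddCircle}
    (hx : ∀ i, i ≠ j → c * |(n i : ℝ)| ≤ (N + 1) * ‖x - T i‖) :
    ∑ i ∈ Finset.univ.erase j, ‖fejerKernel N 0 (x - T i)‖ ≤ Q ∧
    ∑ i ∈ Finset.univ.erase j, ‖fejerKernel N 1 (x - T i)‖ ≤ Q * (1 + 2 * Z) ∧
    ∑ i ∈ Finset.univ.erase j, ‖fejerKernel N 2 (x - T i)‖ ≤ Q * (2 + 4 * Z + 10 * Z ^ 2) ∧
    ∑ i ∈ Finset.univ.erase j, ‖fejerKernel N 3 (x - T i)‖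
      ≤ Q * (4 + 12 * Z + 30 * Z ^ 2 + 80 * Z ^ 3) := by
  have hN' : (129 : ℝ) ≤ N + 1 := by exact_mod_cast (by omega : 129 ≤ N + 1)
  have hsum : ∑ i ∈ Finset.univ.erase j, decay N (x - T i) ≤ Q := by
    refine (sum_decay_le (by omega) hninj hn hc hx).trans (le_trans ?_ hcQ)
    gcongr
    rw [div_le_iff₀ (by positivity)]
    linarith
  have hterm : ∀ i ∈ Finset.univ.erase j, _ := fun i hi => by
    have hi' := Finset.ne_of_mem_erase hi
    have h1 : (1 : ℝ) ≤ |(n i : ℝ)| := by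
      exact_mod_cast Int.one_le_abs (hn i hi').1
    have h2 : c ≤ (N + 1) * ‖x - T i‖ := le_trans (by nlinarith) (hx i hi')
    have h3 : x - T i ≠ 0 := by
      intro h
      rw [h, norm_zero, mul_zero] at h2
      linarith
    exact norm_fejerKernel_le_decay N h3 hZ ((decay_le hN hc h2).trans hcZ)
  refine ⟨(Finset.sum_le_sum fun i hi => (hterm i hi).1).trans hsum, ?_, ?_, ?_⟩
  · refine (Finset.sum_le_sum fun i hi => (hterm i hi).2.1).trans ?_
    rw [← Finset.sum_mul]
    gcongr
  · refine (Finset.sum_le_sum fun i hi => (hterm i hi).2.2.1).trans ?_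
    rw [← Finset.sum_mul]
    gcongr
  · refine (Finset.sum_le_sum fun i hi => (hterm i hi).2.2.2).trans ?_
    rw [← Finset.sum_mul]
    gcongr

lemma le_fejerMoment_two {N : ℕ} (hN : 128 ≤ N) : 0.6666 ≤ fejerMoment N 2 := by
  have hN' : (129 : ℝ) ≤ N + 1 := by exact_mod_cast (by omega : 129 ≤ N + 1)
  have h : 1 / ((N : ℝ) + 1) ^ 2 ≤ 1 / 129 ^ 2 := by gcongr
  rw [fejerMoment_two]
  norm_num at h ⊢
  linarith

lemma fejerMoment_two_le (N : ℕ) : fejerMoment N 2 ≤ 2 / 3 := by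
  rw [fejerMoment_two]
  have : 0 ≤ 1 / ((N : ℝ) + 1) ^ 2 := by positivity
  linarith

lemma interp_eq_add_sum_erase (N : ℕ) (T : Fin s → UnitAddCircle) (α β : Fin s → ℂ) (n : ℕ)
    (x : UnitAddCircle) (j : Fin s) :
    interp N T α β n x = (α j * fejerKernel N n (x - T j) + β j * fejerKernel N (n + 1) (x - T j))
      + ∑ i ∈ Finset.univ.erase j,
        (α i * fejerKernel N n (x - T i) + β i * fejerKernel N (n + 1) (x - T i)) := by
  exact (Finset.add_sum_erase _
    (fun i => α i * fejerKernel N n (x - T i) + β i * fejerKernel N (n + 1) (x - T i))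
    (Finset.mem_univ j)).symm

section Certificate

variable {N : ℕ} {T : Fin s → UnitAddCircle}

/-- A priori bounds on the coefficients of the Hermite interpolant. -/
lemma interp_coeff_bounds (hN : 128 ≤ N) (hT : ∀ i j, i ≠ j → 2.5 / N ≤ ‖T i - T j‖)
    {α β w : Fin s → ℂ} {W : ℝ} (hW : 0 ≤ W) (hw : ∀ j, ‖w j‖ ≤ W)
    (h0 : ∀ j, interp N T α β 0 (T j) = w j) (h1 : ∀ j, interp N T α β 1 (T j) = 0) :
    (∀ j, ‖α j‖ ≤ 1.072 * W) ∧ (∀ j, ‖β j‖ ≤ 0.148 * W) ∧ ∀ j, ‖α j - w j‖ ≤ 0.072 * W := by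
  have hN0 : (0 : ℝ) < N := by exact_mod_cast (by omega : 0 < N)
  choose n hninj hn using exists_rank (by positivity : (0 : ℝ) < 2.5 / N) hT
  have hrank : ∀ j i, i ≠ j → 2.5 * |(n j i : ℝ)| ≤ (N + 1) * ‖T j - T i‖ := by
    intro j i hi
    have h := (hn j i hi).2
    rw [← norm_neg, neg_sub, mul_div_assoc', div_le_iff₀ hN0] at h
    nlinarith [norm_nonneg (T j - T i)]
  -- Here `c = 2.5` is the full separation; `Q` and `Z` are `1/(3c²) + 0.0032` and `√(1/(9.869c²) +
  -- 0.0001)`, rounded up. Later calls use the same recipe.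
  have hsum := fun j => sum_norm_fejerKernel_le hN (x := T j) (c := 2.5) (Z := 0.128)
    (Q := 0.05655) (hninj j) (hn j) (by norm_num) (by norm_num) (by norm_num) (by norm_num)
    (hrank j)
  have e1 : ∀ j, ‖α j - w j‖ ≤ ‖α‖ * 0.05655 + ‖β‖ * (0.05655 * (1 + 2 * 0.128)) := by
    intro j
    obtain ⟨s0, s1, -, -⟩ := hsum j
    have h := h0 j
    rw [interp_eq_add_sum_erase _ _ _ _ _ _ j, sub_self, fejerKernel_zero_apply_zero,
      fejerKernel_one_apply_zero, mul_one, mul_zero, add_zero] at h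
    rw [← h, sub_add_cancel_left, norm_neg]
    exact norm_sum_mul_add_mul_le _ (norm_nonneg _) (norm_nonneg _) (norm_le_pi_norm α)
      (norm_le_pi_norm β) s0 s1
  have e2 : ∀ j, 0.6666 * ‖β j‖ ≤ ‖α‖ * (0.05655 * (1 + 2 * 0.128))
      + ‖β‖ * (0.05655 * (2 + 4 * 0.128 + 10 * 0.128 ^ 2)) := by
    intro j
    obtain ⟨-, s1, s2, -⟩ := hsum j
    have h := h1 j
    rw [interp_eq_add_sum_erase _ _ _ _ _ _ j, sub_self, fejerKernel_two_apply_zero,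
      fejerKernel_one_apply_zero, mul_zero, zero_add, mul_neg, neg_add_eq_zero] at h
    have h2 := norm_sum_mul_add_mul_le (Finset.univ.erase j) (norm_nonneg _) (norm_nonneg _)
      (norm_le_pi_norm α) (norm_le_pi_norm β) s1 s2
    rw [← h, norm_mul, Complex.norm_real,
      Real.norm_of_nonneg ((by norm_num : (0 : ℝ) ≤ 0.6666).trans (le_fejerMoment_two hN))] at h2
    refine le_trans ?_ h2
    rw [mul_comm]
    gcongr
    exact le_fejerMoment_two hN
  have hα0 := norm_nonneg α
  have hβ0 := norm_nonneg β
  -- The value and derivative equations bound the sup norms of `α` and `β` by each other with small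
  -- coefficients, and this linear system can be solved.
  have hα : ‖α‖ ≤ W + (‖α‖ * 0.05655 + ‖β‖ * (0.05655 * (1 + 2 * 0.128))) := by
    refine (pi_norm_le_iff_of_nonneg (by positivity)).2 fun j => ?_
    have : α j = w j + (α j - w j) := by ring
    rw [this]
    exact (norm_add_le _ _).trans (add_le_add (hw j) (e1 j))
  have hβ : ‖β‖ ≤ (‖α‖ * (0.05655 * (1 + 2 * 0.128))
      + ‖β‖ * (0.05655 * (2 + 4 * 0.128 + 10 * 0.128 ^ 2))) / 0.6666 := by
    refine (pi_norm_le_iff_of_nonneg (by positivity)).2 fun j => ?_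
    rw [le_div_iff₀ (by norm_num), mul_comm]
    exact e2 j
  rw [le_div_iff₀ (by norm_num)] at hβ
  have hB : ‖β‖ ≤ 0.138 * ‖α‖ := by
    norm_num at hβ ⊢
    linarith
  have hA : ‖α‖ ≤ 1.072 * W := by
    norm_num at hα hB ⊢
    linarith
  have hB' : ‖β‖ ≤ 0.148 * W := by
    norm_num at hA hB ⊢
    linarith
  refine ⟨fun j => (norm_le_pi_norm α j).trans hA, fun j => (norm_le_pi_norm β j).trans hB',
    fun j => (e1 j).trans ?_⟩
  norm_num at hA hB' ⊢
  linarith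

/-- Hermite interpolation by translates of the Fejér kernel. -/
lemma exists_interp (hN : 128 ≤ N) (hT : ∀ i j, i ≠ j → 2.5 / N ≤ ‖T i - T j‖) (w : Fin s → ℂ) :
    ∃ α β : Fin s → ℂ, (∀ j, interp N T α β 0 (T j) = w j) ∧
      ∀ j, interp N T α β 1 (T j) = 0 := by
  let L : ((Fin s → ℂ) × (Fin s → ℂ)) →ₗ[ℂ] ((Fin s → ℂ) × (Fin s → ℂ)) :=
    { toFun := fun p => (fun j => interp N T p.1 p.2 0 (T j), fun j => interp N T p.1 p.2 1 (T j))
      map_add' := by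
        intro p q
        ext j <;> simp only [interp, Prod.fst_add, Prod.snd_add, Pi.add_apply,
          ← Finset.sum_add_distrib] <;> exact Finset.sum_congr rfl fun i _ => by ring
      map_smul' := by
        intro c p
        ext j <;> simp only [interp, Prod.smul_fst, Prod.smul_snd, Pi.smul_apply, smul_eq_mul,
          Finset.mul_sum, RingHom.id_apply] <;> exact Finset.sum_congr rfl fun i _ => by ring }
  -- The a priori bounds with `W = 0` force zero coefficients; an injective endomorphism in finite
  -- dimension is surjective.
  have hinj : Function.Injective L := by
    rw [injective_iff_map_eq_zero]
    rintro ⟨α, β⟩ h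
    have h0 : ∀ j, interp N T α β 0 (T j) = (0 : Fin s → ℂ) j := fun j =>
      congrFun (congrArg Prod.fst h) j
    have h1 : ∀ j, interp N T α β 1 (T j) = 0 := fun j => congrFun (congrArg Prod.snd h) j
    obtain ⟨hα, hβ, -⟩ := interp_coeff_bounds hN hT le_rfl (by simp) h0 h1
    ext j
    · simpa using hα j
    · simpa using hβ j
  obtain ⟨⟨α, β⟩, h⟩ := LinearMap.surjective_of_injective hinj (w, 0)
  exact ⟨α, β, fun j => congrFun (congrArg Prod.fst h) j,
    fun j => congrFun (congrArg Prod.snd h) j⟩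

/-- The size of the interpolant close to one of the points. -/
lemma norm_interp_le_near (hN : 128 ≤ N) (hT : ∀ i j, i ≠ j → 2.5 / N ≤ ‖T i - T j‖)
    {α β w : Fin s → ℂ} {W : ℝ} (hW : 0 ≤ W) (hw : ∀ j, ‖w j‖ ≤ W)
    (h0 : ∀ j, interp N T α β 0 (T j) = w j) (h1 : ∀ j, interp N T α β 1 (T j) = 0)
    {x : UnitAddCircle} {j : Fin s} (hx : (N + 1) * ‖x - T j‖ ≤ 0.4) :
    ‖interp N T α β 0 x‖ ≤ ‖w j‖ * (1 - 0.263 * (Real.pi * (N + 1) * ‖x - T j‖) ^ 2)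
      + 0.244 * W * (Real.pi * (N + 1) * ‖x - T j‖) ^ 2 := by
  have hN0 : (0 : ℝ) < N := by exact_mod_cast (by omega : 0 < N)
  obtain ⟨hα, hβ, hαw⟩ := interp_coeff_bounds hN hT hW hw h0 h1
  obtain ⟨n, hninj, hn⟩ := exists_rank (by positivity : (0 : ℝ) < 2.5 / N) hT j
  obtain ⟨h, hh, habs⟩ := exists_coe_eq_abs_eq_norm (x - T j)
  set c : ℝ := Real.pi * (N + 1) with hc
  have hcC : (Real.pi : ℂ) * (N + 1) = (c : ℂ) := by rw [hc]; push_cast; ring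
  -- The interpolant is compared with the single bump `w j * K`. Near `T j` the other points remain
  -- at least `2.5 - 0.4 = 2.1` times their rank away, in units of `1 / (N + 1)`.
  have hE2 : ∀ t : ℝ, |t| ≤ 0.4 / (N + 1) →
      ‖interp N T α β 2 (T j + t) - w j * fejerKernel N 2 t‖ ≤ 0.488 * W := by
    intro t ht
    rw [le_div_iff₀ (by positivity)] at ht
    have htn : ‖(t : UnitAddCircle)‖ ≤ |t| := by
      rw [UnitAddCircle.norm_eq]
      exact round_le t 0 |>.trans (by simp)
    obtain ⟨-, -, s2, s3⟩ := sum_norm_fejerKernel_le hN (x := T j + t) (c := 2.1) (Z := 0.1522)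
      (Q := 0.0788) hninj hn (by norm_num) (by norm_num) (by norm_num) (by norm_num) fun i hi => by
        have h2 := (hn i hi).2
        have h3 : (1 : ℝ) ≤ |(n i : ℝ)| := by exact_mod_cast Int.one_le_abs (hn i hi).1
        rw [mul_div_assoc', div_le_iff₀ hN0] at h2
        have h4 : ‖T i - T j‖ ≤ ‖T j + t - T i‖ + ‖(t : UnitAddCircle)‖ := by
          have : T i - T j = (t : UnitAddCircle) - (T j + t - T i) := by abel
          rw [this]
          exact (norm_sub_le _ _).trans (le_of_eq (add_comm _ _))
        have h5 : ‖T i - T j‖ ≤ ‖T j + t - T i‖ + |t| := h4.trans (by gcongr)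
        nlinarith [norm_nonneg (T i - T j)]
    have e : interp N T α β 2 (T j + t) - w j * fejerKernel N 2 t
        = ((α j - w j) * fejerKernel N 2 t + β j * fejerKernel N 3 t)
          + ∑ i ∈ Finset.univ.erase j, (α i * fejerKernel N 2 (T j + t - T i)
            + β i * fejerKernel N 3 (T j + t - T i)) := by
      rw [interp_eq_add_sum_erase _ _ _ _ _ _ j, add_sub_cancel_left]
      ring
    rw [e]
    have n2 := (norm_fejerKernel_le N 2 t).trans (fejerMoment_two_le N)
    have n3 := (norm_fejerKernel_le N 3 t).trans (fejerMoment_three_le N)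
    calc _ ≤ (0.072 * W * (2 / 3) + 0.148 * W * (4 / 5))
          + (1.072 * W * (0.0788 * (2 + 4 * 0.1522 + 10 * 0.1522 ^ 2))
            + 0.148 * W * (0.0788 * (4 + 12 * 0.1522 + 30 * 0.1522 ^ 2 + 80 * 0.1522 ^ 3))) := by
          refine (norm_add_le _ _).trans (add_le_add ((norm_add_le _ _).trans ?_)
            (norm_sum_mul_add_mul_le _ (by positivity) (by positivity) hα hβ s2 s3))
          rw [norm_mul, norm_mul]
          gcongr
          · exact hαw j
          · exact hβ j
      _ ≤ 0.488 * W := by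
          norm_num
          linarith
  have hk : ∀ (n : ℕ) (t : ℝ), HasDerivAt (fun t : ℝ => fejerKernel N n t)
      (c * fejerKernel N (n + 1) t) t := by
    intro n t
    have := hasDerivAt_fejerKernel N n 0 t
    rw [hcC] at this
    simpa using this
  have hG : ∀ (n : ℕ) (t : ℝ), HasDerivAt (fun t : ℝ => interp N T α β n (T j + t))
      (c * interp N T α β (n + 1) (T j + t)) t := by
    intro n t
    have := hasDerivAt_interp N T α β n (T j) t
    rwa [hcC] at this
  -- The difference vanishes to second order at `T j`, since `K(0) = 1` and `K'(0) = 0`; the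
  -- constant `0.244` is half of `0.488`.
  have htaylor := norm_le_of_norm_second_deriv_le
    (f := fun t : ℝ => interp N T α β 0 (T j + t) - w j * fejerKernel N 0 t)
    (f' := fun t : ℝ => c * (interp N T α β 1 (T j + t) - w j * fejerKernel N 1 t))
    (f'' := fun t : ℝ => c * (c * (interp N T α β 2 (T j + t) - w j * fejerKernel N 2 t)))
    (C := c ^ 2 * (0.488 * W)) (r := 0.4 / (N + 1)) (t := h)
    (fun t => by
      convert! (hG 0 t).sub ((hk 0 t).const_mul (w j)) using 1
      ring)
    (fun t => by
      convert! ((hG 1 t).sub ((hk 1 t).const_mul (w j))).const_mul (c : ℂ) using 1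
      ring)
    (by simp [h0, fejerKernel_zero_apply_zero])
    (by simp [h1, fejerKernel_one_apply_zero])
    (fun t ht => by
      have hc0 : 0 ≤ c := by rw [hc]; positivity
      rw [norm_mul, norm_mul, Complex.norm_real, Real.norm_of_nonneg hc0, ← mul_assoc, ← sq]
      gcongr
      exact hE2 t ht)
    (by
      rw [habs, le_div_iff₀ (by positivity), mul_comm]
      exact hx)
  have hk0 := norm_fejerKernel_zero_le N (h : UnitAddCircle)
  rw [hh, ← hc] at hk0
  simp only [hh, add_sub_cancel] at htaylor
  have hτ2 : (c * ‖x - T j‖) ^ 2 ≤ 1.58 := by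
    have : c * ‖x - T j‖ ≤ 3.1416 * 0.4 := by
      rw [hc, mul_assoc]
      exact mul_le_mul Real.pi_lt_d4.le hx (by positivity) (by norm_num)
    have h2 : 0 ≤ c * ‖x - T j‖ := by rw [hc]; positivity
    nlinarith
  have hE : ‖interp N T α β 0 x - w j * fejerKernel N 0 (x - T j)‖
      ≤ 0.244 * W * (c * ‖x - T j‖) ^ 2 := by
    refine htaylor.trans (le_of_eq ?_)
    rw [← sq_abs h, habs]
    ring
  set q := (c * ‖x - T j‖) ^ 2 with hq
  have hq0 : 0 ≤ q := sq_nonneg _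
  -- For `q ≤ 1.58`, `0.6666 / 2 - (2/45) q ≥ 0.263`.
  have hk1 : ‖fejerKernel N 0 (x - T j)‖ ≤ 1 - 0.263 * q := by
    refine hk0.trans ?_
    have h4 : (c * ‖x - T j‖) ^ 4 = q * q := by rw [hq]; ring
    have h5 := le_fejerMoment_two hN
    rw [h4]
    norm_num at h5 hτ2 ⊢
    nlinarith
  calc ‖interp N T α β 0 x‖
      = ‖w j * fejerKernel N 0 (x - T j)
        + (interp N T α β 0 x - w j * fejerKernel N 0 (x - T j))‖ := by
        congr 1; ring
    _ ≤ ‖w j‖ * ‖fejerKernel N 0 (x - T j)‖ + 0.244 * W * q := by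
        rw [← norm_mul]
        exact (norm_add_le _ _).trans (by gcongr)
    _ ≤ _ := by gcongr

lemma norm_interp_le_of_sums {α β : Fin s → ℂ} {A B : ℝ} (hA : 0 ≤ A) (hB : 0 ≤ B)
    (hα : ∀ j, ‖α j‖ ≤ A) (hβ : ∀ j, ‖β j‖ ≤ B) {x : UnitAddCircle} {j : Fin s} {X Y z : ℝ}
    (hj : ‖fejerKernel N 0 (x - T j)‖ ≤ z)
    (hX : ∑ i ∈ Finset.univ.erase j, ‖fejerKernel N 0 (x - T i)‖ ≤ X)
    (hY : ∑ i ∈ Finset.univ.erase j, ‖fejerKernel N 1 (x - T i)‖ ≤ Y) :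
    ‖interp N T α β 0 x‖ ≤ A * (z + X) + B * (2 / 3 + Y) := by
  have h1 := (norm_fejerKernel_le N 1 (x - T j)).trans (fejerMoment_one_le N)
  refine norm_sum_mul_add_mul_le _ hA hB hα hβ ?_ ?_
  · rw [← Finset.add_sum_erase _ (fun i => ‖fejerKernel N 0 (x - T i)‖) (Finset.mem_univ j)]
    exact add_le_add hj hX
  · rw [← Finset.add_sum_erase _ (fun i => ‖fejerKernel N 1 (x - T i)‖) (Finset.mem_univ j)]
    exact add_le_add h1 hY

lemma norm_fejerKernel_zero_le_of_le (hN : 128 ≤ N) {x : UnitAddCircle} {c z : ℝ} (hc : 0 < c)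
    (hx : c ≤ (N + 1) * ‖x‖) (hz : 1 / (9.869 * c ^ 2) + 0.0001 ≤ z) :
    ‖fejerKernel N 0 x‖ ≤ z := by
  have hx0 : x ≠ 0 := by
    rintro rfl
    rw [norm_zero, mul_zero] at hx
    linarith
  have h := (norm_fejerKernel_le_decay N hx0 (Real.sqrt_nonneg (decay N x))
    (Real.sq_sqrt (decay_nonneg N x)).ge).1
  exact h.trans ((decay_le hN hc hx).trans hz)

/-- The size of the interpolant away from the points. -/
lemma norm_interp_le_far (hN : 128 ≤ N) (hT : ∀ i j, i ≠ j → 2.5 / N ≤ ‖T i - T j‖)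
    {α β w : Fin s → ℂ} {W : ℝ} (hW : 0 ≤ W) (hw : ∀ j, ‖w j‖ ≤ W)
    (h0 : ∀ j, interp N T α β 0 (T j) = w j) (h1 : ∀ j, interp N T α β 1 (T j) = 0)
    {x : UnitAddCircle} (hx : ∀ j, 0.4 < (N + 1) * ‖x - T j‖) :
    ‖interp N T α β 0 x‖ ≤ 0.9 * W := by
  rcases isEmpty_or_nonempty (Fin s) with hs | hs
  · simp only [interp, Finset.univ_eq_empty, Finset.sum_empty, norm_zero]
    positivity
  have hN0 : (0 : ℝ) < N := by exact_mod_cast (by omega : 0 < N)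
  obtain ⟨hα, hβ, -⟩ := interp_coeff_bounds hN hT hW hw h0 h1
  obtain ⟨j, hj⟩ := Finite.exists_min fun i => ‖x - T i‖
  obtain ⟨n, hninj, hn⟩ := exists_rank (by positivity : (0 : ℝ) < 2.5 / N) hT j
  have htri : ∀ i, i ≠ j → 2.5 * |(n i : ℝ)| ≤ (N + 1) * ‖x - T i‖ + (N + 1) * ‖x - T j‖ := by
    intro i hi
    have h2 := (hn i hi).2
    rw [mul_div_assoc', div_le_iff₀ hN0] at h2
    have h4 : ‖T i - T j‖ ≤ ‖x - T i‖ + ‖x - T j‖ := by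
      have : T i - T j = (x - T j) - (x - T i) := by abel
      rw [this]
      exact (norm_sub_le _ _).trans (le_of_eq (add_comm _ _))
    nlinarith [norm_nonneg (T i - T j)]
  -- Below `0.5` the other points are at least `2` times their rank away. Above it, minimality of
  -- the distance to `T j` gives only `1.25`, half the separation, but the bump at `T j` is smaller.
  rcases le_total ((N + 1) * ‖x - T j‖) 0.5 with h | h
  · obtain ⟨s0, s1, -, -⟩ := sum_norm_fejerKernel_le hN (x := x) (c := 2) (Z := 0.16)
      (Q := 0.0866) hninj hn (by norm_num) (by norm_num) (by norm_num) (by norm_num) fun i hi => by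
        have h3 : (1 : ℝ) ≤ |(n i : ℝ)| := by exact_mod_cast Int.one_le_abs (hn i hi).1
        linarith [htri i hi]
    have hk := norm_fejerKernel_zero_le_of_le hN (z := 0.6335) (by norm_num) (hx j).le
      (by norm_num)
    refine (norm_interp_le_of_sums (by positivity) (by positivity) hα hβ hk s0 s1).trans ?_
    norm_num
    linarith
  · obtain ⟨s0, s1, -, -⟩ := sum_norm_fejerKernel_le hN (x := x) (c := 1.25) (Z := 0.255)
      (Q := 0.2166) hninj hn (by norm_num) (by norm_num) (by norm_num) (by norm_num) fun i hi => by
        have h3 : ((N : ℝ) + 1) * ‖x - T j‖ ≤ (N + 1) * ‖x - T i‖ := by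
          gcongr
          exact hj i
        linarith [htri i hi]
    have hk := norm_fejerKernel_zero_le_of_le hN (z := 0.4055) (by norm_num) h (by norm_num)
    refine (norm_interp_le_of_sums (by positivity) (by positivity) hα hβ hk s0 s1).trans ?_
    norm_num
    linarith

/-- Existence of interpolating trigonometric polynomials with quadratic decay around the points. -/
theorem exists_certificate (hN : 128 ≤ N) (hT : ∀ i j, i ≠ j → 2.5 / N ≤ ‖T i - T j‖)
    (w : Fin s → ℂ) {W : ℝ} (hW : 0 ≤ W) (hw : ∀ j, ‖w j‖ ≤ W) :
    ∃ p : Freq N → ℂ, (∀ j, trigPoly p (T j) = w j) ∧ ∀ x,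
      (∃ j, ‖trigPoly p x‖ ≤ ‖w j‖ * (1 - 0.263 * (Real.pi * (N + 1) * ‖x - T j‖) ^ 2)
        + 0.244 * W * (Real.pi * (N + 1) * ‖x - T j‖) ^ 2 ∧ (N + 1) * ‖x - T j‖ ≤ 0.4) ∨
      ‖trigPoly p x‖ ≤ 0.9 * W := by
  obtain ⟨α, β, h0, h1⟩ := exists_interp hN hT w
  obtain ⟨p, hp⟩ := exists_trigPoly_eq_interp N T α β
  refine ⟨p, fun j => (hp _).trans (h0 j), fun x => ?_⟩
  rw [hp]
  by_cases hx : ∃ j, (N + 1) * ‖x - T j‖ ≤ 0.4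
  · obtain ⟨j, hj⟩ := hx
    exact Or.inl ⟨j, norm_interp_le_near hN hT hW hw h0 h1 hj, hj⟩
  · push Not at hx
    exact Or.inr (norm_interp_le_far hN hT hW hw h0 h1 hx)

end Certificate

end SpikeDetection

/-! ### Localization of the atoms and of the support of a solution. -/

namespace SpikeDetection

variable {fc s : ℕ} {T : Fin s → UnitAddCircle} {lam : ℝ} {a θ : Fin s → ℝ} {ε : Freq fc → ℂ}
  {μ : ComplexMeasure UnitAddCircle}

lemma norm_exp_neg_I_mul (t : ℝ) : ‖Complex.exp (-(Complex.I * (t : ℂ)))‖ = 1 := by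
  have h : -(Complex.I * (t : ℂ)) = ((-t : ℝ) : ℂ) * Complex.I := by push_cast; ring
  rw [h, Complex.norm_exp_ofReal_mul_I]

lemma le_pi_mul_sq (fc : ℕ) {d r : ℝ} (hr : 0 ≤ r) (h : r ≤ fc * d) :
    9.869 * r ^ 2 ≤ (Real.pi * (fc + 1) * d) ^ 2 := by
  have hd : 0 ≤ fc * d := hr.trans h
  have hd0 : 0 ≤ d ∨ (fc : ℝ) = 0 := by
    rcases eq_or_lt_of_le (Nat.cast_nonneg (α := ℝ) fc) with h | h
    · exact Or.inr h.symm
    · exact Or.inl (nonneg_of_mul_nonneg_right hd h)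
  rcases hd0 with hd0 | h0
  · have h1 : r ≤ (fc + 1) * d := by nlinarith
    have h2 := Real.pi_gt_d6
    rw [mul_assoc, mul_pow]
    gcongr
    nlinarith
  · have : r = 0 := le_antisymm (by rw [h0, zero_mul] at h; exact h) hr
    rw [this]
    norm_num
    positivity

/-- The certificate interpolating the conjugate phases is tested with `C = 1`. The constants come
from `0.019 * 9.869 > 0.187` and `½ (5/4)² < 0.782`; the far alternative would give `0.1 |μ{x}| ≤
0.782 λ`. -/
lemma exists_dist_sq_le_of_solution (hfc : 128 ≤ fc)
    (hT : ∀ i j, i ≠ j → 2.5 / fc ≤ ‖T i - T j‖) (hlam : 0 < lam) (ha : ∀ j, 0 < a j)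
    (hε : ∑ k, ‖ε k‖ ^ 2 ≤ (lam / 4) ^ 2)
    (hμ : IsBlassoSolution fc lam (fun k => fourierSample (spikeTrain a θ T) k + ε k) μ)
    {x : UnitAddCircle} (hx : 218 * lam ≤ ‖μ {x}‖) :
    ∃ j, 0.187 * (fc * dist x (T j)) ^ 2 * ‖μ {x}‖ ≤ 0.782 * lam := by
  obtain ⟨p, hp, hpx⟩ := exists_certificate hfc hT
    (fun j => Complex.exp (-(Complex.I * (θ j : ℂ)))) zero_le_one
    (fun j => (norm_exp_neg_I_mul (θ j)).le)
  simp only [norm_exp_neg_I_mul, one_mul, mul_one] at hpx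
  have hp1 : ∀ x, ‖trigPoly p x‖ ≤ 1 := by
    intro x
    rcases hpx x with ⟨j, hj, -⟩ | h
    · norm_num at hj
      nlinarith [sq_nonneg (Real.pi * (fc + 1) * ‖x - T j‖)]
    · norm_num at h
      linarith
  have hmain := (one_sub_norm_mul_norm_singleton_le μ (trigPoly p) hp1 x).trans
    (tvNorm_sub_integral_norm_le hlam ha θ T ε hε μ hμ p zero_le_one hp1)
  have hzero : ∑ j, a j * (1 - (trigPoly p (T j) * Complex.exp (Complex.I * (θ j : ℂ))).re) = 0 := by
    refine Finset.sum_eq_zero fun j _ => ?_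
    rw [hp, ← Complex.exp_add, neg_add_cancel, Complex.exp_zero, Complex.one_re, sub_self, mul_zero]
  rw [hzero, zero_add] at hmain
  have hm : 0 < ‖μ {x}‖ := lt_of_lt_of_le (by positivity) hx
  rcases hpx x with ⟨j, hj, -⟩ | h
  · refine ⟨j, ?_⟩
    rw [← dist_eq_norm] at hj
    have hq := le_pi_mul_sq fc (d := dist x (T j)) (by positivity) le_rfl
    have h1 : 0.187 * (fc * dist x (T j)) ^ 2 ≤ 1 - ‖trigPoly p x‖ := by
      norm_num at hj hq ⊢
      nlinarith
    have h2 := mul_le_mul_of_nonneg_right h1 hm.le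
    norm_num at hmain h2 ⊢
    linarith
  · exfalso
    have h1 : 0.1 * ‖μ {x}‖ ≤ (1 - ‖trigPoly p x‖) * ‖μ {x}‖ := by
      gcongr
      norm_num at h ⊢
      linarith
    norm_num at hmain h1
    linarith

lemma exists_mem_supp_dist_le_of_solution (hfc : 128 ≤ fc)
    (hT : ∀ i j, i ≠ j → 2.5 / fc ≤ ‖T i - T j‖) (hlam : 0 < lam) (ha : ∀ j, 0 < a j)
    (hε : ∑ k, ‖ε k‖ ^ 2 ≤ (lam / 4) ^ 2)
    (hμ : IsBlassoSolution fc lam (fun k => fourierSample (spikeTrain a θ T) k + ε k) μ)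
    {j : Fin s} (hj : 218 * lam < a j) :
    ∃ t ∈ supp μ, dist (T j) t ≤ √(lam / (0.1678 * (a j - 218 * lam))) * (1 / (fc : ℝ)) := by
  have hfc0 : (0 : ℝ) < fc := by exact_mod_cast (by omega : 0 < fc)
  by_contra! hcon
  have hgap : 0 < a j - 218 * lam := by linarith
  set R := lam / (0.1678 * (a j - 218 * lam)) with hR
  have hR0 : 0 < R := by positivity
  -- Outside radius `√R / f_c`, `0.019 τ² ≥ 0.019 * 9.869 R ≥ 0.18 R ≥ b`. The cap `0.01` keeps `|p|
  -- ≤ 1` near the other spikes, as `0.244 * 1.01 < 0.263`, and far away.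
  set b := min (0.18 * R) 0.01 with hb
  have hb0 : 0 < b := lt_min (by positivity) (by norm_num)
  have hb1 : b ≤ 0.01 := min_le_right _ _
  have hbR : b ≤ 0.18 * R := min_le_left _ _
  set c : Fin s → ℝ := fun i => if i = j then 1 + b else 1 with hc
  have hc1 : ∀ i, 1 ≤ c i := fun i => by
    simp only [hc]
    split_ifs <;> linarith
  have hcb : ∀ i, c i ≤ 1 + b := fun i => by
    simp only [hc]
    split_ifs <;> linarith
  have hnorm : ∀ i, ‖(c i : ℂ) * Complex.exp (-(Complex.I * (θ i : ℂ)))‖ = c i := fun i => by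
    rw [norm_mul, norm_exp_neg_I_mul, mul_one, Complex.norm_real,
      Real.norm_of_nonneg (zero_le_one.trans (hc1 i))]
  obtain ⟨p, hp, hpx⟩ := exists_certificate hfc hT
    (fun i => (c i : ℂ) * Complex.exp (-(Complex.I * (θ i : ℂ)))) (W := 1 + b) (by linarith)
    (fun i => (hnorm i).le.trans (hcb i))
  simp only [hnorm] at hpx
  have hp1 : ∀ x, ‖trigPoly p x‖ ≤ 1 + b := by
    intro x
    rcases hpx x with ⟨i, hi, hi'⟩ | h
    · refine hi.trans ?_
      have hq : (Real.pi * (fc + 1) * ‖x - T i‖) ^ 2 ≤ 1.6 := by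
        have h1 : Real.pi * (fc + 1) * ‖x - T i‖ ≤ 3.15 * 0.4 := by
          rw [mul_assoc]
          exact mul_le_mul Real.pi_lt_d2.le hi' (by positivity) (by norm_num)
        have h2 : 0 ≤ Real.pi * (fc + 1) * ‖x - T i‖ := by positivity
        nlinarith
      have hq0 : 0 ≤ (Real.pi * (fc + 1) * ‖x - T i‖) ^ 2 := sq_nonneg _
      set q := (Real.pi * (fc + 1) * ‖x - T i‖) ^ 2
      have h3 : c i * (1 - 0.263 * q) ≤ (1 + b) * (1 - 0.263 * q) := by
        apply mul_le_mul_of_nonneg_right (hcb i)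
        norm_num at hq ⊢
        linarith
      have h4 : 0 ≤ (1 + b) * q := by positivity
      norm_num at h3 ⊢
      nlinarith
    · norm_num at h
      linarith
  -- Near `T j` the bound is `(1 + b)(1 - 0.019 q) ≤ (1 + b)(1 - b) ≤ 1`.
  have hsupp : ∀ x ∈ supp μ, ‖trigPoly p x‖ ≤ 1 := by
    intro x hx
    rcases hpx x with ⟨i, hi, -⟩ | h
    · refine hi.trans ?_
      have hq0 : 0 ≤ (Real.pi * (fc + 1) * ‖x - T i‖) ^ 2 := sq_nonneg _
      by_cases hij : i = j
      · have hd := hcon x hx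
        rw [dist_comm, dist_eq_norm, mul_one_div, div_lt_iff₀ hfc0, mul_comm, ← hij] at hd
        have hq := le_pi_mul_sq fc (Real.sqrt_nonneg _) hd.le
        rw [Real.sq_sqrt hR0.le] at hq
        have hci : c i = 1 + b := by simp [hc, hij]
        rw [hci]
        set q := (Real.pi * (fc + 1) * ‖x - T i‖) ^ 2
        have h1 : b ≤ 0.019 * q := by
          norm_num at hq hbR ⊢
          linarith
        norm_num at h1 ⊢
        nlinarith
      · have hci : c i = 1 := by simp [hc, hij]
        rw [hci]
        norm_num at hb1 ⊢
        nlinarith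
    · norm_num at h hb1
      linarith
  have hmain := (tvNorm_sub_integral_norm_nonneg μ (trigPoly p) hsupp).trans
    (tvNorm_sub_integral_norm_le hlam ha θ T ε hε μ hμ p (by linarith) hp1)
  have hsum : ∑ i, a i * (1 - (trigPoly p (T i) * Complex.exp (Complex.I * (θ i : ℂ))).re)
      = -(a j * b) := by
    have h1 : ∀ i, a i * (1 - (trigPoly p (T i) * Complex.exp (Complex.I * (θ i : ℂ))).re)
        = if i = j then -(a j * b) else 0 := by
      intro i
      rw [hp, mul_assoc, ← Complex.exp_add, neg_add_cancel, Complex.exp_zero, mul_one,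
        Complex.ofReal_re]
      by_cases hij : i = j
      · simp only [hc, hij, if_true]
        ring
      · simp [hc, hij]
    simp_rw [h1]
    simp
  rw [hsum] at hmain
  have hκ : a j * b ≤ 0.794 * lam := by
    have h1 : (1 / 4 + (1 + b)) ^ 2 ≤ 1.588 := by
      norm_num at hb1 ⊢
      nlinarith
    have h2 : 1 / 2 * (1 / 4 + (1 + b)) ^ 2 * lam ≤ 0.794 * lam := by
      gcongr
      norm_num at h1 ⊢
      linarith
    linarith
  -- If `b = 0.18 R`, then `0.18 a_j ≤ 0.794 * 0.1678 (a_j - 218 λ) < 0.18 a_j`. If `b = 0.01`, then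
  -- `a_j ≤ 79.4 λ`.
  rcases min_choice (0.18 * R) 0.01 with h | h
  · rw [hb, h, hR] at hκ
    have h1 : a j * (0.18 * (lam / (0.1678 * (a j - 218 * lam))))
        = 0.18 * a j * lam / (0.1678 * (a j - 218 * lam)) := by ring
    rw [h1, div_le_iff₀ (by positivity)] at hκ
    have h2 : 0 < a j * lam := mul_pos (ha j) hlam
    have h3 : 0 < lam * lam := mul_pos hlam hlam
    norm_num at hκ
    nlinarith
  · rw [hb, h] at hκ
    norm_num at hκ
    linarith

end SpikeDetection

/-! ### Assembly of the theorem. -/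

theorem mainTheorem3 {Ω : Type*} [MeasurableSpace Ω] (P : Measure Ω) [IsProbabilityMeasure P]
    (fc : ℕ) (hfc : 128 ≤ fc)
    -- the noise: real and imaginary parts are i.i.d. centered Gaussian, standard deviation `σ`
    (σ : ℝ≥0) (hσ : 0 < σ)
    (ε₁ ε₂ : SpikeDetection.Freq fc → Ω → ℝ)
    (hε₁ : ∀ k, HasLaw (ε₁ k) (gaussianReal 0 (σ ^ 2)) P)
    (hε₂ : ∀ k, HasLaw (ε₂ k) (gaussianReal 0 (σ ^ 2)) P)
    (hindep : iIndepFun (Sum.elim ε₁ ε₂) P)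
    -- the target `∑ⱼ aⱼ exp(i θⱼ) δ_{Tⱼ}`, with support `Set.range T`
    (s : ℕ) (a θ : Fin s → ℝ) (T : Fin s → UnitAddCircle)
    (ha : ∀ j, 0 < a j) (hT : Function.Injective T)
    (hsep : ENNReal.ofReal (2.5 / (fc : ℝ)) ≤ (Set.range T).einfsep)
    -- the tuning parameter
    (lam : ℝ) (hlam : SpikeDetection.lambdaF σ fc ≤ lam) :
    ∃ A : Set Ω, MeasurableSet A ∧
      1 - 2 * Real.exp (-(Real.log fc * (lam ^ 2 / SpikeDetection.lambdaF σ fc ^ 2))) ≤ P.real A ∧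
      ∀ ω ∈ A, ∀ Δhat : ComplexMeasure UnitAddCircle,
        SpikeDetection.IsBlassoSolution fc lam
          (fun k => SpikeDetection.fourierSample (SpikeDetection.spikeTrain a θ T) k
            + ((ε₁ k ω : ℂ) + Complex.I * (ε₂ k ω : ℂ))) Δhat →
        (∀ x : UnitAddCircle, 218 * lam ≤ ‖Δhat {x}‖ →
          ∃ j, dist x (T j) ≤ √(lam / (0.1678 * ‖Δhat {x}‖)) * (1 / (fc : ℝ)) ∧
            dist x (T j) ≤ 0.1649 / (fc : ℝ) ∧
            ∀ i, dist x (T i) ≤ √(lam / (0.1678 * ‖Δhat {x}‖)) * (1 / (fc : ℝ)) → i = j) ∧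
        (∀ j, 218 * lam < a j →
          ∃ t ∈ SpikeDetection.supp Δhat,
            dist (T j) t ≤ √(lam / (0.1678 * (a j - 218 * lam))) * (1 / (fc : ℝ))) := by
  have hfc0 : (0 : ℝ) < fc := by exact_mod_cast (by omega : 0 < fc)
  have hlam0 : 0 < lam :=
    (SpikeDetection.lambdaF_pos (by exact_mod_cast hσ) (by omega)).trans_le hlam
  have hsep' : ∀ i j, i ≠ j → 2.5 / (fc : ℝ) ≤ ‖T i - T j‖ := by
    intro i j hij
    have h := Set.le_edist_of_le_einfsep (Set.mem_range_self i) (Set.mem_range_self j)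
      (hT.ne hij) hsep
    rw [edist_dist, ENNReal.ofReal_le_ofReal_iff dist_nonneg, dist_eq_norm] at h
    exact h
  obtain ⟨A, hA, hPA, hnoise⟩ := SpikeDetection.exists_noise_event P fc hfc σ hσ ε₁ ε₂ hε₁ hε₂
    hindep lam hlam
  refine ⟨A, hA, hPA, fun ω hω Δhat hΔ => ⟨fun x hx => ?_, fun j hj =>
    SpikeDetection.exists_mem_supp_dist_le_of_solution hfc hsep' hlam0 ha (hnoise ω hω) hΔ hj⟩⟩
  obtain ⟨j, hj⟩ := SpikeDetection.exists_dist_sq_le_of_solution hfc hsep' hlam0 ha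
    (hnoise ω hω) hΔ hx
  set m := ‖Δhat {x}‖ with hm
  have hm0 : 0 < m := lt_of_lt_of_le (by positivity) hx
  have hd1 : dist x (T j) ≤ √(lam / (0.1678 * m)) * (1 / (fc : ℝ)) := by
    rw [mul_one_div, le_div_iff₀ hfc0, mul_comm]
    apply Real.le_sqrt_of_sq_le
    rw [le_div_iff₀ (by positivity)]
    norm_num at hj ⊢
    linarith
  have hd2 : dist x (T j) ≤ 0.1649 / (fc : ℝ) := by
    rw [le_div_iff₀ hfc0, mul_comm]
    refine le_of_sq_le_sq ?_ (by norm_num)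
    have h1 : (0.187 * (fc * dist x (T j)) ^ 2) * (218 * lam) ≤ 0.782 * lam :=
      (mul_le_mul_of_nonneg_left hx (by positivity)).trans hj
    have h2 : (0.187 * (fc * dist x (T j)) ^ 2) * 218 ≤ 0.782 := by
      refine le_of_mul_le_mul_right ?_ hlam0
      linarith
    norm_num at h2 ⊢
    linarith
  refine ⟨j, hd1, hd2, fun i hi => ?_⟩
  by_contra hij
  -- Since `m ≥ 218 λ`, the radicand is at most `1 / (0.1678 * 218) < 0.2²`; two candidates would
  -- then be within `0.3649 / f_c` of each other, below the separation `2.5 / f_c`.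
  have h1 : √(lam / (0.1678 * m)) ≤ 0.2 := by
    apply Real.sqrt_le_iff.2
    refine ⟨by norm_num, ?_⟩
    rw [div_le_iff₀ (by positivity)]
    norm_num
    linarith
  have h2 : dist x (T i) ≤ 0.2 / (fc : ℝ) := by
    refine hi.trans ?_
    rw [mul_one_div]
    gcongr
  have h3 := hsep' i j hij
  rw [← dist_eq_norm] at h3
  have h4 : 2.5 / (fc : ℝ) ≤ 0.2 / fc + 0.1649 / fc :=
    h3.trans ((dist_triangle_left _ _ x).trans (add_le_add h2 hd2))
  rw [← add_div, div_le_div_iff_of_pos_right hfc0] at h4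
  norm_num at h4
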